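/- Fix an integer $n\ge 3$ and put $t=1+2\cos(\pi/n)$, $A=\begin{pmatrix}1&t\\0&1\end{pmatrix}$, $C=\begin{pmatrix}-1&1\\-1&0\end{pmatrix}$, acting on $\mathbb R\cup\{\infty\}$ by Möbius transformations. For $\alpha\in[0,1]$ put $\ell_0(\alpha)=(\alpha-1)t$, $r_0(\alpha)=\alpha t$ and $\mathbb I_\alpha=[\ell_0(\alpha),r_0(\alpha))$. For $x\in[\ell_0(\alpha),r_0(\alpha)]$ let $T_\alpha(x)=A^kC^l\cdot x$, where $l\ge 1$ is minimal with $C^l\cdot x\notin\mathbb I_\alpha$ and $k=-\lfloor (C^l\cdot x)/t+1-\alpha\rfloor$; the pair $(k,l)$ is the $\alpha$-digit of $x$ (there is none if $C^l\cdot x=\infty$), and the digit sequence of $x$ consists of the digits of $x,T_\alpha(x),T_\alpha^2(x),\dots$. Let $\gamma_{3,n}\in[0,1]$ be defined by $C^{-1}\cdot\ell_0(\gamma_{3,n})=r_0(\gamma_{3,n})$. Words. For a word $v=c_1d_1c_2\cdots d_{s-1}c_s$ in positive integers, $s\ge1$, let $v'=1\,(c_1-1)\,d_1c_2\cdots d_{s-1}c_s$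 if $c_1\ne1$, and $v'=(d_1+1)\,c_2\cdots d_{s-1}c_s$ if $c_1=1$ and $s>1$. Put $\Theta_{-1}(c)=c+1$ for one-letter words $c\geq 1$, $\Theta_q(1)=1\,q\,1$ for $q\ge1$, and $\Theta_q(c)=c\,[1\,(c-1)]^q\,1\,c$ for $c>1$, $q\ge0$ ($\Theta_0(1)$ is undefined). Recursively, if $v=\Theta_p(u)=u\,v''$ with $p\ge0$, put $\Theta_q(v)=v\,(v')^q\,v''$ for $q\ge0$. Let $\mathcal V$ be the set of all words obtained from the word $1$ by finitely many applications of the operators $\Theta_q$; for $v\in\mathcal V$ put $q'=-1$ if $v$ has one letter and $q'=0$ otherwise. For an integer $k\ge1$ and $v=c_1d_1\cdots d_{s-1}c_s\in\mathcal V$, let $\mathscr I_{k,v}$ be the set of $\alpha\in[0,1]$ for which the digit sequence of $r_0(\alpha)$ begins with $(k,1)^{c_1}(k+1,1)^{d_1}\cdots(k+1,1)^{d_{s-1}}(k,1)^{c_s}$, let $R_{k,v}=(A^kC)^{c_s}(A^{k+1}C)^{d_{s-1}}\cdots(A^{k+1}C)^{d_1}(A^kC)^{c_1}$, and let $\zeta_{k,v},\eta_{k,v}\in[0,1]$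 be defined by $$R_{k,v}\cdot r_0(\zeta_{k,v})=\ell_0(\zeta_{k,v}),\qquad C^{-1}ACR_{k,v}\cdot r_0(\eta_{k,v})=r_0(\eta_{k,v}).$$ **Theorem.** The numbers $\gamma_{3,n}$, $\zeta_{k,v}$, $\eta_{k,v}$ exist and are uniquely determined in $[0,1]$, and $\zeta_{k,v}<\eta_{k,v}$. Let $\mathscr J_{k,v}=[\zeta_{k,v},\eta_{k,v})$. Then: 1. $(0,\gamma_{3,n})=\bigcup_{k=1}^{\infty}\mathscr I_{k,1}$, a disjoint union. 2. For all $k\ge1$ and $v\in\mathcal V$, one has $$\mathscr I_{k,v}=\mathscr J_{k,v}\ \cup\ \{\eta_{k,v}\}\ \cup\ \bigcup_{q\ge q'}\mathscr I_{k,\Theta_q(v)},$$ where the sets on the right are pairwise disjoint (and $q=0$ is omitted if $v=1$). 3. The closure of $(0,\gamma_{3,n})\setminus\bigcup_{k\ge1,\,v\in\mathcal V}\mathscr J_{k,v}$ equals $[0,\gamma_{3,n}]\setminus\bigcup_{k\ge1,\,v\in\mathcal V}(\zeta_{k,v},\eta_{k,v})$, and this set is a Cantor set, that is, nonempty, compact,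 perfect and totally disconnected. -/

import Mathlib

open scoped Real

noncomputable section

namespace AlphaCF

/-! ### The groups, the intervals and the maps -/

/-- `μ_m = 2 cos (π / m)`; also `ν_n = μ_n`. -/
def mu (m : ℕ) : ℝ := 2 * Real.cos (π / m)

/-- `t_{m,n} = 2 cos (π / m) + 2 cos (π / n)`. -/
def t (m n : ℕ) : ℝ := mu m + mu n

/-- The generator `A`, the translation by `t`. -/
def A (m n : ℕ) : GL (Fin 2) ℝ :=
  Matrix.GeneralLinearGroup.mkOfDetNeZero !![1, t m n; 0, 1] (by simp [Matrix.det_fin_two])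

/-- The generator `C`. -/
def C (m : ℕ) : GL (Fin 2) ℝ :=
  Matrix.GeneralLinearGroup.mkOfDetNeZero !![-mu m, 1; -1, 0] (by simp [Matrix.det_fin_two])

/-- Left endpoint `ℓ₀(α) = (α - 1) t`. -/
def ell0 (m n : ℕ) (α : ℝ) : ℝ := (α - 1) * t m n

/-- Right endpoint `r₀(α) = α t`. -/
def r0 (m n : ℕ) (α : ℝ) : ℝ := α * t m n

/-- The half-open interval `𝕀_α = [ℓ₀(α), r₀(α))`. -/
def II (m n : ℕ) (α : ℝ) : Set ℝ := Set.Ico (ell0 m n α) (r0 m n α)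

/-- `TStep m n α x k l y`: the point `x` has `α`-digit `(k, l)` and `T_α x = A ^ k C ^ l · x = y`.
Here matrices act on `ℝ ∪ {∞}` by Möbius transformations, `l ≥ 1` is minimal with
`C ^ l · x ∉ 𝕀_α`, and `k = -⌊(C ^ l · x) / t + 1 - α⌋`. A point with `C ^ l · x = ∞` has no digit. -/
def TStep (m n : ℕ) (α x : ℝ) (k : ℤ) (l : ℕ) (y : ℝ) : Prop :=
  1 ≤ l ∧
  (∀ j : ℕ, 1 ≤ j → j < l → ∃ z ∈ II m n α, C m ^ j • (x : OnePoint ℝ) = (z : OnePoint ℝ)) ∧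
  (∃ z : ℝ, z ∉ II m n α ∧ C m ^ l • (x : OnePoint ℝ) = (z : OnePoint ℝ) ∧
    k = -⌊z / t m n + 1 - α⌋) ∧
  (A m n ^ k * C m ^ l) • (x : OnePoint ℝ) = (y : OnePoint ℝ)

/-- `HasDigits m n α b x`: the sequence of `α`-digits of the `T_α`-orbit of `x` begins with `b`. -/
def HasDigits (m n : ℕ) (α : ℝ) : List (ℤ × ℕ) → ℝ → Prop
  | [], _ => True
  | (k, l) :: b, x => ∃ y : ℝ, TStep m n α x k l y ∧ HasDigits m n α b y

/-! ### Words

A word `v = c₁ d₁ c₂ ⋯ d_{s-1} c_s` is the list of its letters. -/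

/-- Auxiliary to `digitSeq`: the run lengths of a list are used for `a` and `b` alternately. -/
def runs (a b : ℤ) : List ℕ → List ℤ
  | [] => []
  | c :: w => List.replicate c a ++ runs b a w

/-- The upper simplified digit sequence `k^{c₁}, (k+1)^{d₁}, …, (k+1)^{d_{s-1}}, k^{c_s}`. -/
def digitSeq (k : ℕ) (v : List ℕ) : List ℤ := runs k (k + 1) v

/-- Auxiliary to `rightMatrix`: as `runs`, the first letter being the rightmost factor. -/
def runMatrix (n : ℕ) (a b : ℤ) : List ℕ → GL (Fin 2) ℝ
  | [] => 1
  | c :: w => runMatrix n b a w * (A 3 n ^ a * C 3) ^ c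

/-- The right matrix
`R_{k,v} = (A^k C)^{c_s} (A^{k+1} C)^{d_{s-1}} ⋯ (A^{k+1} C)^{d₁} (A^k C)^{c₁}`, for `m = 3`. -/
def rightMatrix (n k : ℕ) (v : List ℕ) : GL (Fin 2) ℝ := runMatrix n k (k + 1) v

/-- The `α`-cylinder `𝓘_{k,v}`: those `α ∈ [0, 1]` for which the digits of `r₀(α)` begin with
`digitSeq k v`, all exponents of `C` being one (`m = 3`). -/
def alphaCylinder (n k : ℕ) (v : List ℕ) : Set ℝ :=
  {α | α ∈ Set.Icc (0 : ℝ) 1 ∧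
    HasDigits 3 n α ((digitSeq k v).map fun d => (d, 1)) (r0 3 n α)}

/-- The equation that defines `γ_{3,n}`. -/
def IsGamma (n : ℕ) (α : ℝ) : Prop :=
  α ∈ Set.Icc (0 : ℝ) 1 ∧ (C 3)⁻¹ • (ell0 3 n α : OnePoint ℝ) = (r0 3 n α : OnePoint ℝ)

/-- The equation that defines the left endpoint `ζ_{k,v}`. -/
def IsZeta (n k : ℕ) (v : List ℕ) (α : ℝ) : Prop :=
  α ∈ Set.Icc (0 : ℝ) 1 ∧
    rightMatrix n k v • (r0 3 n α : OnePoint ℝ) = (ell0 3 n α : OnePoint ℝ)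

/-- The equation that defines the right endpoint `η_{k,v}`. -/
def IsEta (n k : ℕ) (v : List ℕ) (α : ℝ) : Prop :=
  α ∈ Set.Icc (0 : ℝ) 1 ∧
    ((C 3)⁻¹ * A 3 n * C 3 * rightMatrix n k v) • (r0 3 n α : OnePoint ℝ) =
      (r0 3 n α : OnePoint ℝ)

/-! ### The tree of words -/

/-- The word `v'`: `1 (c₁ - 1) d₁ c₂ ⋯ c_s` if `c₁ ≠ 1`, and `(d₁ + 1) c₂ ⋯ c_s` if `c₁ = 1`;
also `1' = 1`. -/
def prime : List ℕ → List ℕ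
  | [] => []
  | [1] => [1]
  | 1 :: d :: w => (d + 1) :: w
  | c :: w => 1 :: (c - 1) :: w

/-- The power `w ^ q` of a word under concatenation. -/
def wpow (w : List ℕ) (q : ℕ) : List ℕ := (List.replicate q w).flatten

/-- A word together with the way in which it is obtained: `single c` is the one-letter word `c`,
and `child q u` is the word `Θ_q(u)`, `q ≥ 0`. -/
inductive Node : Type
  | single (c : ℕ) : Node
  | child (q : ℕ) (u : Node) : Node

/-- The pair `(v, v'')` of a node. For `v = Θ_p(u)`, `v''` is the suffix with `v = u v''`;
a one-letter word has no such suffix, and the second component is not used.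
* `Θ_q(1) = 1 q 1`, and `Θ_q(c) = c [1 (c-1)]^q 1 c` for `c > 1`;
* `Θ_q(v) = v (v')^q v''` if `v = Θ_p(u) = u v''` with `p ≥ 0`. -/
def Node.wordSuffix : Node → List ℕ × List ℕ
  | .single c => ([c], [])
  | .child q (.single c) =>
      if c = 1 then ([1] ++ [q, 1], [q, 1])
      else ([c] ++ (wpow [1, c - 1] q ++ [1, c]), wpow [1, c - 1] q ++ [1, c])
  | .child q (.child p u) =>
      let vs := (Node.child p u).wordSuffix
      (vs.1 ++ (wpow (prime vs.1) q ++ vs.2), wpow (prime vs.1) q ++ vs.2)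

/-- The word of a node. -/
def Node.word (v : Node) : List ℕ := v.wordSuffix.1

/-- The `q` for which `Θ_q(v)` is defined: all `q ≥ q'`, where `q' = -1` if `v = c₁` and `q' = 0`
otherwise, except that `Θ_0(1)` is undefined. -/
def Node.indices : Node → Set ℤ
  | .single c => {q | -1 ≤ q ∧ ¬ (c = 1 ∧ q = 0)}
  | .child _ _ => {q | 0 ≤ q}

/-- The operators `Θ_q`, with `Θ_{-1}(c) = c + 1`; used for `q ∈ v.indices` only. -/
def Node.Theta (q : ℤ) : Node → Node
  | .single c => if q = -1 then .single (c + 1) else .child q.toNat (.single c)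
  | .child p u => .child q.toNat (.child p u)

/-- The tree `𝒱` of all words obtained from `1` by finitely many applications of the `Θ_q`. -/
inductive InTree : Node → Prop
  | one : InTree (.single 1)
  | theta {v : Node} {q : ℤ} : InTree v → q ∈ v.indices → InTree (v.Theta q)

/-! ### Cantor sets -/

/-- A Cantor set: nonempty, compact, perfect (closed without isolated points) and totally
disconnected. -/
def IsCantorSet (S : Set ℝ) : Prop :=
  S.Nonempty ∧ IsCompact S ∧ Perfect S ∧ IsTotallyDisconnected S

end AlphaCF

end

/-!
Put `x = r₀(α) = α t`, so that `𝕀_α = [x - t, x)`, and `c = k t + 1`. For `k ≥ 1` the condition on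
the exponent of `C` holds automatically, and the digits of the orbit of `x` are `k` and `k + 1` as
prescribed by a binary word exactly if the inverse branches `y ↦ 1 / (c - y)` and
`y ↦ 1 / (c + t - y)` recover `x` and all intermediate points from a point of `[x - t, x)`. On
`(-∞, 1]` these branches are increasing contractions by the factor `1/4`, with values in
`(0, 1/2]`. Hence, if `pull w` is the composite of the branches along `w`, the defining equations
`pull w (x - t) = x` of `ζ` and `pull w (x / (1 + t x)) = x` of `η` are fixed-point equations of
contractions, with one solution each, which moreover separates the signs of the differences.

The tree of words becomes uniform in binary notation. With a word `V` go the words `a = V'`, which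
is `V` with its first letter changed, and `b = V''`, and the children of `V` are the words `V a^q b`
for all `q ≥ 0`, with `a^(q+1) b` and `a^q b` in place of `a` and `b`; the shift of the index at
one-letter words and the exception `Θ_0(1)` disappear (`isCompatible_of_inTree`). One step in the
tree is composed of two elementary moves, `b ↦ ab` and `V, a ↦ Vb, ab`. The structure `Inv` lists
properties preserved by both; besides the facts about a single orbit they are the identity
`pull (ab) y = pull b (pull V y - t)`, which makes the ranges of the continuations `a` and `b`
adjacent, and a description of the right end `ω` of the range of `V`. They give that the parameters
with word `V` form the interval `[ζ_V, ω_V)` (`cyl_triple_iff`), where `ω` is inherited by the child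
with `q = 0` and equals the number `ζ` of the child number `q` for the child number `q + 1`, that
`ζ_V < η_V < ω_V`, and that the numbers `ζ` of the children decrease to `η_V`.

What remains is a statement about trees of intervals (`GapTree`). Since the lengths of the intervals
tend to zero by contraction, every point outside the gaps is a limit of right ends `η` of gaps
different from it; this yields the closure, the absence of isolated points, and, as each `η` has
points of a gap immediately to its left, total disconnectedness. The values `k = 1, 2, …` are
treated as the children of a root with `η = 0` and `ω = γ`.
-/

namespace AlphaCF

/-! ### A fixed-point principle -/

section Contractions


/-- `z` is the fixed point of `H` in `(0, 1)`, and `H` lies above the diagonal to the left of `z`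
and below it to the right. -/
def IsCrossing (H : ℝ → ℝ) (z : ℝ) : Prop :=
  z ∈ Set.Ioo (0 : ℝ) 1 ∧ H z = z ∧
    ∀ x ∈ Set.Icc (0 : ℝ) 1, (x < z → x < H x) ∧ (z < x → H x < x)

theorem exists_isCrossing {H : ℝ → ℝ}
    (hH : ∀ x ∈ Set.Icc (0 : ℝ) 1, ∀ x' ∈ Set.Icc (0 : ℝ) 1, x < x' →
      0 ≤ H x' - H x ∧ H x' - H x ≤ (x' - x) / 4)
    (h0 : 0 < H 0) (h1 : H 1 < 1) : ∃ z, IsCrossing H z := by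
  have hc : ContinuousOn H (Set.Icc 0 1) := by
    have : LipschitzOnWith 1 H (Set.Icc 0 1) := by
      refine LipschitzOnWith.of_dist_le_mul fun x hx y hy => ?_
      rw [Real.dist_eq, Real.dist_eq, NNReal.coe_one, one_mul]
      rcases lt_trichotomy x y with h | h | h
      · have := hH x hx y hy h
        rw [abs_sub_comm, abs_sub_comm x, abs_of_nonneg this.1, abs_of_pos (sub_pos.2 h)]
        linarith
      · simp [h]
      · have := hH y hy x hx h
        rw [abs_of_nonneg this.1, abs_of_pos (sub_pos.2 h)]
        linarith
    exact this.continuousOn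
  have h01 : (0 : ℝ) ≤ 1 := zero_le_one
  have key : (0 : ℝ) ∈ (fun x => x - H x) '' Set.Icc 0 1 := by
    apply intermediate_value_Icc h01 (continuousOn_id.sub hc)
    constructor <;> simp <;> linarith
  obtain ⟨z, hz, hz0⟩ := key
  have hzz : H z = z := by simp only at hz0; linarith
  have hz1 : z ≠ 0 := fun h => by rw [h] at hzz; linarith
  have hz2 : z ≠ 1 := fun h => by rw [h] at hzz; linarith
  refine ⟨z, ⟨lt_of_le_of_ne hz.1 (Ne.symm hz1), lt_of_le_of_ne hz.2 hz2⟩, hzz,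
    fun x hx => ⟨fun h => ?_, fun h => ?_⟩⟩
  · have := hH x hx z hz h
    linarith
  · have := hH z hz x hx h
    linarith

theorem IsCrossing.le_iff {H : ℝ → ℝ} {z x : ℝ} (h : IsCrossing H z)
    (hx : x ∈ Set.Icc (0 : ℝ) 1) : z ≤ x ↔ H x ≤ x := by
  constructor
  · intro h1
    rcases h1.eq_or_lt with rfl | h1
    · exact h.2.1.le
    · exact ((h.2.2 x hx).2 h1).le
  · intro h1
    by_contra! h2
    exact absurd ((h.2.2 x hx).1 h2) (not_lt.2 h1)

theorem IsCrossing.lt_iff {H : ℝ → ℝ} {z x : ℝ} (h : IsCrossing H z)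
    (hx : x ∈ Set.Icc (0 : ℝ) 1) : z < x ↔ H x < x := by
  constructor
  · exact (h.2.2 x hx).2
  · intro h1
    by_contra! h2
    rcases h2.eq_or_lt with rfl | h2
    · exact h1.ne h.2.1
    · exact absurd ((h.2.2 x hx).1 h2) (not_lt.2 h1.le)

theorem IsCrossing.eq_iff {H : ℝ → ℝ} {z x : ℝ} (h : IsCrossing H z)
    (hx : x ∈ Set.Icc (0 : ℝ) 1) : x = z ↔ H x = x := by
  have h1 := h.le_iff hx
  have h2 := h.lt_iff hx
  constructor
  · rintro rfl
    exact h.2.1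
  · intro h3
    have h4 := h1.2 h3.le
    have h5 : ¬ z < x := fun h6 => (h2.1 h6).ne h3
    exact le_antisymm (not_lt.1 h5) h4

/-! ### Inverse branches -/

/-- The inverse branches of the maps `y ↦ A ^ d C · y`, where `c = k t + 1`: the letter `false`
stands for the digit `d = k`, the letter `true` for `d = k + 1`. -/
noncomputable def branch (c t : ℝ) : Bool → ℝ → ℝ
  | false, y => 1 / (c - y)
  | true, y => 1 / (c + t - y)

/-- The composite of the inverse branches along a word: `pull c t w y` is the point from which the
digits `w` lead to `y`. -/
noncomputable def pull (c t : ℝ) : List Bool → ℝ → ℝ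
  | [], y => y
  | d :: w, y => branch c t d (pull c t w y)

variable {c t : ℝ}

theorem pull_append (u w : List Bool) (y : ℝ) :
    pull c t (u ++ w) y = pull c t u (pull c t w y) := by
  induction u with
  | nil => rfl
  | cons d u ih => simp [pull, ih]

theorem one_div_sub_contract {a y y' : ℝ} (ha : 3 ≤ a) (h : y < y') (h' : y' ≤ 1) :
    1 / (a - y) < 1 / (a - y') ∧ 1 / (a - y') - 1 / (a - y) ≤ (y' - y) / 4 := by
  have h1 : 2 ≤ a - y' := by linarith
  have h2 : 2 ≤ a - y := by linarith
  constructor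
  · exact one_div_lt_one_div_of_lt (by linarith) (by linarith)
  · rw [div_sub_div _ _ (by linarith) (by linarith), div_le_div_iff₀ (by nlinarith) (by norm_num)]
    have : 4 ≤ (a - y') * (a - y) := by nlinarith
    nlinarith

theorem branch_contract (hc : 3 ≤ c) (ht : 2 ≤ t) (d : Bool) {y y' : ℝ} (h : y < y')
    (h' : y' ≤ 1) : branch c t d y < branch c t d y' ∧
      branch c t d y' - branch c t d y ≤ (y' - y) / 4 := by
  cases d
  · exact one_div_sub_contract hc h h'
  · exact one_div_sub_contract (by linarith) h h'

theorem branch_bounds (hc : 3 ≤ c) (ht : 2 ≤ t) (d : Bool) {y : ℝ} (h : y ≤ 1) :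
    0 < branch c t d y ∧ branch c t d y ≤ 1 / 2 := by
  cases d
  · exact ⟨one_div_pos.2 (by linarith), one_div_le_one_div_of_le (by norm_num) (by linarith)⟩
  · exact ⟨one_div_pos.2 (by linarith), one_div_le_one_div_of_le (by norm_num) (by linarith)⟩

theorem pull_le_one (hc : 3 ≤ c) (ht : 2 ≤ t) (w : List Bool) {y : ℝ} (h : y ≤ 1) :
    pull c t w y ≤ 1 := by
  induction w with
  | nil => exact h
  | cons d w ih => exact (branch_bounds hc ht d ih).2.trans (by norm_num)

theorem pull_bounds (hc : 3 ≤ c) (ht : 2 ≤ t) {w : List Bool} (hw : w ≠ []) {y : ℝ} (h : y ≤ 1) :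
    0 < pull c t w y ∧ pull c t w y ≤ 1 / 2 := by
  cases w with
  | nil => exact absurd rfl hw
  | cons d w => exact branch_bounds hc ht d (pull_le_one hc ht w h)

theorem pull_contract (hc : 3 ≤ c) (ht : 2 ≤ t) (w : List Bool) {y y' : ℝ} (h : y < y')
    (h' : y' ≤ 1) : pull c t w y < pull c t w y' ∧
      pull c t w y' - pull c t w y ≤ (y' - y) / 4 ^ w.length := by
  induction w with
  | nil => simpa [pull] using h
  | cons d w ih =>
    have := branch_contract hc ht d ih.1 (pull_le_one hc ht w h')
    refine ⟨this.1, this.2.trans ?_⟩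
    rw [List.length_cons, pow_succ, ← div_div]
    linarith [ih.2]

theorem pull_lt_pull (hc : 3 ≤ c) (ht : 2 ≤ t) (w : List Bool) {y y' : ℝ} (h : y < y')
    (h' : y' ≤ 1) : pull c t w y < pull c t w y' :=
  (pull_contract hc ht w h h').1

theorem pull_le_pull (hc : 3 ≤ c) (ht : 2 ≤ t) (w : List Bool) {y y' : ℝ} (h : y ≤ y')
    (h' : y' ≤ 1) : pull c t w y ≤ pull c t w y' := by
  rcases h.eq_or_lt with rfl | h
  · exact le_rfl
  · exact (pull_lt_pull hc ht w h h').le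

theorem pull_lt_iff (hc : 3 ≤ c) (ht : 2 ≤ t) (w : List Bool) {y y' : ℝ} (h : y ≤ 1)
    (h' : y' ≤ 1) : pull c t w y < pull c t w y' ↔ y < y' := by
  refine ⟨fun h1 => ?_, fun h1 => pull_lt_pull hc ht w h1 h'⟩
  by_contra! h2
  exact absurd (pull_le_pull hc ht w h2 h) (not_le.2 h1)

theorem pull_le_iff (hc : 3 ≤ c) (ht : 2 ≤ t) (w : List Bool) {y y' : ℝ} (h : y ≤ 1)
    (h' : y' ≤ 1) : pull c t w y ≤ pull c t w y' ↔ y ≤ y' := by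
  rw [← not_lt, pull_lt_iff hc ht w h' h, not_lt]

theorem pull_sub_le (hc : 3 ≤ c) (ht : 2 ≤ t) {w : List Bool} (hw : w ≠ []) {y y' : ℝ}
    (h : y < y') (h' : y' ≤ 1) : pull c t w y' - pull c t w y ≤ (y' - y) / 4 := by
  refine (pull_contract hc ht w h h').2.trans ?_
  refine div_le_div_of_nonneg_left (by linarith) (by norm_num) ?_
  calc (4 : ℝ) = 4 ^ 1 := by norm_num
    _ ≤ 4 ^ w.length := pow_le_pow_right₀ (by norm_num) (List.length_pos_iff.2 hw)

theorem continuousOn_pull (hc : 3 ≤ c) (ht : 2 ≤ t) (w : List Bool) :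
    ContinuousOn (pull c t w) (Set.Iic 1) := by
  induction w with
  | nil => exact continuousOn_id
  | cons d w ih =>
    have h2 : ∀ y ∈ Set.Iic (1 : ℝ), pull c t w y ≤ 1 := fun y hy => pull_le_one hc ht w hy
    have : ContinuousOn (branch c t d) (Set.Iic 1) := by
      cases d
      · refine ContinuousOn.div continuousOn_const (by fun_prop) fun y hy => ?_
        have : y ≤ 1 := hy
        linarith
      · refine ContinuousOn.div continuousOn_const (by fun_prop) fun y hy => ?_
        have : y ≤ 1 := hy
        linarith
    exact this.comp ih h2

/-! ### The endpoints `ζ` and `η` -/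

theorem exists_isCrossing_zeta (hc : 3 ≤ c) (ht : 2 ≤ t) {w : List Bool} (hw : w ≠ []) :
    ∃ z, IsCrossing (fun x => pull c t w (x - t)) z := by
  apply exists_isCrossing
  · intro x hx x' hx' h
    have h1 : x' - t ≤ 1 := by linarith [hx'.2]
    have h2 : x - t < x' - t := by linarith
    have h3 := pull_lt_pull hc ht w h2 h1
    have h4 := pull_sub_le hc ht hw h2 h1
    exact ⟨by linarith, by linarith⟩
  · exact (pull_bounds hc ht hw (by linarith)).1
  · exact (pull_bounds hc ht hw (by linarith)).2.trans_lt (by norm_num)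

theorem div_one_add_mul_contract {x x' : ℝ} (ht : 2 ≤ t) (hx : 0 ≤ x) (h : x < x') :
    x / (1 + t * x) < x' / (1 + t * x') ∧
      x' / (1 + t * x') - x / (1 + t * x) ≤ x' - x := by
  have h1 : 1 ≤ 1 + t * x := by nlinarith
  have h2 : 1 ≤ 1 + t * x' := by nlinarith
  constructor
  · rw [div_lt_div_iff₀ (by linarith) (by linarith)]
    nlinarith
  · rw [div_sub_div _ _ (by linarith) (by linarith), div_le_iff₀ (by nlinarith)]
    have : 1 ≤ (1 + t * x') * (1 + t * x) := by nlinarith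
    nlinarith

theorem div_one_add_mul_le {x : ℝ} (ht : 2 ≤ t) (hx : 0 ≤ x) :
    0 ≤ x / (1 + t * x) ∧ x / (1 + t * x) ≤ 1 := by
  have h1 : 0 < 1 + t * x := by nlinarith
  refine ⟨by positivity, ?_⟩
  rw [div_le_one h1]
  nlinarith

theorem exists_isCrossing_eta (hc : 3 ≤ c) (ht : 2 ≤ t) {w : List Bool} (hw : w ≠ []) :
    ∃ z, IsCrossing (fun x => pull c t w (x / (1 + t * x))) z := by
  apply exists_isCrossing
  · intro x hx x' hx' h
    have h1 := (div_one_add_mul_le ht hx'.1).2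
    have h2 := div_one_add_mul_contract ht hx.1 h
    have h3 := pull_lt_pull hc ht w h2.1 h1
    have h4 := pull_sub_le hc ht hw h2.1 h1
    exact ⟨by linarith, by linarith⟩
  · exact (pull_bounds hc ht hw (by simp)).1
  · exact (pull_bounds hc ht hw (div_one_add_mul_le ht zero_le_one).2).2.trans_lt (by norm_num)

theorem exists_isCrossing_branch (hc : 3 ≤ c) (ht : 2 ≤ t) :
    ∃ z, IsCrossing (branch c t false) z := by
  apply exists_isCrossing
  · intro x hx x' hx' h
    have := branch_contract hc ht false h hx'.2
    exact ⟨by linarith, this.2⟩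
  · exact (branch_bounds hc ht _ (by norm_num)).1
  · exact (branch_bounds hc ht _ (by norm_num)).2.trans_lt (by norm_num)

/-- The point `x = ζ t` at which the digits `w` lead from `x = r₀` to `x - t = ℓ₀`. -/
noncomputable def zeta (c t : ℝ) (w : List Bool) : ℝ :=
  Classical.epsilon (IsCrossing fun x => pull c t w (x - t))

/-- The point `x = η t` at which the digits `w` lead from `x = r₀` to
`C⁻¹ A⁻¹ C · x = x / (1 + t x)`. -/
noncomputable def eta (c t : ℝ) (w : List Bool) : ℝ :=
  Classical.epsilon (IsCrossing fun x => pull c t w (x / (1 + t * x)))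

/-- The fixed point in `(0, 1)` of `A ^ k C`. -/
noncomputable def fixedPt (c t : ℝ) : ℝ :=
  Classical.epsilon (IsCrossing (branch c t false))

theorem zeta_spec (hc : 3 ≤ c) (ht : 2 ≤ t) {w : List Bool} (hw : w ≠ []) :
    IsCrossing (fun x => pull c t w (x - t)) (zeta c t w) :=
  Classical.epsilon_spec (exists_isCrossing_zeta hc ht hw)

theorem eta_spec (hc : 3 ≤ c) (ht : 2 ≤ t) {w : List Bool} (hw : w ≠ []) :
    IsCrossing (fun x => pull c t w (x / (1 + t * x))) (eta c t w) :=
  Classical.epsilon_spec (exists_isCrossing_eta hc ht hw)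

theorem fixedPt_spec (hc : 3 ≤ c) (ht : 2 ≤ t) : IsCrossing (branch c t false) (fixedPt c t) :=
  Classical.epsilon_spec (exists_isCrossing_branch hc ht)

theorem zeta_lt_eta (hc : 3 ≤ c) (ht : 2 ≤ t) {w : List Bool} (hw : w ≠ []) :
    zeta c t w < eta c t w := by
  have h1 := zeta_spec hc ht hw
  have h2 := eta_spec hc ht hw
  have hI : zeta c t w ∈ Set.Icc (0 : ℝ) 1 := ⟨h1.1.1.le, h1.1.2.le⟩
  rw [← not_le, h2.le_iff hI, not_le]
  have h3 := div_one_add_mul_le ht hI.1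
  conv_lhs => rw [← h1.2.1]
  exact pull_lt_pull hc ht w (by linarith [hI.2, h3.1]) h3.2

end Contractions

/-! ### Admissible words -/

section Words

variable {c t : ℝ}


/-- `Adm c t x w y`: all points of the orbit piece that leads from `pull c t w y` to `y` by the
digits `w`, except possibly the first, lie in `[x - t, x)`. -/
def Adm (c t x : ℝ) : List Bool → ℝ → Prop
  | [], _ => True
  | _ :: w, y => pull c t w y ∈ Set.Ico (x - t) x ∧ Adm c t x w y

/-- The orbit of the right endpoint `x` of `[x - t, x)` begins with the digits `w`. -/
def Cyl (c t : ℝ) (w : List Bool) (x : ℝ) : Prop :=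
  ∃ y, x = pull c t w y ∧ Adm c t x w y

theorem adm_append {x : ℝ} (u w : List Bool) (y : ℝ) :
    Adm c t x (u ++ w) y ↔ Adm c t x u (pull c t w y) ∧ Adm c t x w y := by
  induction u with
  | nil => simp [Adm]
  | cons d u ih => simp [Adm, ih, pull_append, and_assoc]

theorem Adm.mem_Ico {x : ℝ} {w : List Bool} (hw : w ≠ []) {y : ℝ} (h : Adm c t x w y) :
    y ∈ Set.Ico (x - t) x := by
  induction w with
  | nil => exact absurd rfl hw
  | cons d w ih =>
    rcases eq_or_ne w [] with rfl | h1
    · exact h.1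
    · exact ih h1 h.2

theorem Cyl.of_append {x : ℝ} {u w : List Bool} (h : Cyl c t (u ++ w) x) : Cyl c t u x := by
  obtain ⟨y, h1, h2⟩ := h
  exact ⟨pull c t w y, by rw [h1, pull_append], ((adm_append _ _ _).1 h2).1⟩

theorem Cyl.zeta_le (hc : 3 ≤ c) (ht : 2 ≤ t) {x : ℝ} {w : List Bool} (hw : w ≠ [])
    (hx : x ∈ Set.Icc (0 : ℝ) 1) (h : Cyl c t w x) : zeta c t w ≤ x := by
  obtain ⟨y, h1, h2⟩ := h
  rw [(zeta_spec hc ht hw).le_iff hx]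
  have h3 := h2.mem_Ico hw
  conv_rhs => rw [h1]
  exact pull_le_pull hc ht w h3.1 (h3.2.le.trans hx.2)

/-- A point determines its digits: the ranges of the two inverse branches on an interval
`[x - t, x)` are disjoint. -/
theorem branch_false_ne_branch_true {x y y' : ℝ}
    (h : y ∈ Set.Ico (x - t) x) (h' : y' ∈ Set.Ico (x - t) x) :
    branch c t false y ≠ branch c t true y' := by
  intro h1
  simp only [branch, one_div, inv_inj] at h1
  linarith [h.1, h'.2]

theorem branch_inj {d : Bool} {y y' : ℝ}
    (h1 : branch c t d y = branch c t d y') : y = y' := by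
  cases d <;> simp only [branch, one_div, inv_inj] at h1 <;> linarith

theorem not_adm_of_clash {x : ℝ} (p u w : List Bool)
    {y y' : ℝ}
    (hz : pull c t (p ++ false :: u) y = pull c t (p ++ true :: w) y')
    (h : Adm c t x (p ++ false :: u) y) (h' : Adm c t x (p ++ true :: w) y') : False := by
  induction p with
  | nil => exact branch_false_ne_branch_true h.1 h'.1 hz
  | cons d p ih => exact ih (branch_inj hz) h.2 h'.2

theorem not_cyl_of_clash {x : ℝ} (p u w : List Bool)
    (h : Cyl c t (p ++ false :: u) x) (h' : Cyl c t (p ++ true :: w) x) : False := by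
  obtain ⟨y, h1, h2⟩ := h
  obtain ⟨y', h1', h2'⟩ := h'
  exact not_adm_of_clash p u w (h1.symm.trans h1') h2 h2'

/-! ### The invariant of the tree of words -/

/-- The `q`-th power of a binary word. -/
def bpow (a : List Bool) (q : ℕ) : List Bool := (List.replicate q a).flatten

@[simp] theorem bpow_zero (a : List Bool) : bpow a 0 = [] := rfl

theorem bpow_succ (a : List Bool) (q : ℕ) : bpow a (q + 1) = a ++ bpow a q := by
  simp [bpow, List.replicate_succ]

theorem bpow_succ' (a : List Bool) (q : ℕ) : bpow a (q + 1) = bpow a q ++ a := by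
  simp [bpow, List.replicate_succ']

/-- The properties of a triple of words `V`, `a = V'`, `b = V''` that are preserved when `b` is
replaced by `ab`, and when `V, a` are replaced by `Vb, ab`. The points `x` whose orbit begins with
`V` fill `[ζ, ω)`, and those among them with `η < x` continue by `a` or by `b`. -/
structure Inv (c t : ℝ) (V a b : List Bool) (ω : ℝ) : Prop where
  ne_V : V ≠ []
  ne_a : a ≠ []
  ne_b : b ≠ []
  pull_ab : ∀ y ≤ 1, pull c t (a ++ b) y = pull c t b (pull c t V y - t)
  pull_a : ∀ y ≤ 1, pull c t a y = pull c t V y / (1 + t * pull c t V y)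
  /-- `r` is the supremum of the points from which the digits `b` are possible if `x = ω`. -/
  right_end : ∃ r, 0 < r ∧ r < 1 ∧ pull c t V r = ω ∧ pull c t b r = r ∧ pull c t a r < r
  /-- `y` is the point reached by the digits `V`; the digits `b` lead to the points below `m`. -/
  orbit : ∀ x, zeta c t V ≤ x → x < ω → ∃ y m, x - t ≤ y ∧ x = pull c t V y ∧ Adm c t x V y ∧
    y ≤ m ∧ m ≤ pull c t b m ∧ y < pull c t b m ∧ m ≤ 1 ∧
    (∀ y', x - t ≤ y' → y' < m → Adm c t x b y') ∧
    (∀ y', x - t ≤ y' → y' < pull c t b y → Adm c t x a y')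

variable {V a b : List Bool} {ω : ℝ}

namespace Inv

theorem base (hc : 3 ≤ c) (ht : 2 ≤ t) :
    Inv c t [false] [true] [false] (fixedPt c t) where
  ne_V := by simp
  ne_a := by simp
  ne_b := by simp
  pull_ab y hy := by
    simp only [List.cons_append, List.nil_append, pull, branch]
    congr 1
    ring
  pull_a y hy := by
    simp only [pull, branch]
    have h1 : c - y ≠ 0 := by linarith
    have h2 : c + t - y ≠ 0 := by linarith
    have h3 : c - y + t ≠ 0 := by linarith
    field_simp
    ring
  right_end := by
    have h := fixedPt_spec hc ht
    refine ⟨fixedPt c t, h.1.1, h.1.2, h.2.1, h.2.1, ?_⟩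
    conv_rhs => rw [← h.2.1]
    simp only [pull, branch]
    exact one_div_lt_one_div_of_lt (by linarith [h.1.2]) (by linarith)
  orbit x hx1 hx2 := by
    have h := fixedPt_spec hc ht
    have hz := zeta_spec hc ht (w := [false]) (by simp)
    have hx0 : 0 < x := hz.1.1.trans_le hx1
    have hxI : x ∈ Set.Icc (0 : ℝ) 1 := ⟨hx0.le, (hx2.trans h.1.2).le⟩
    have h1 : 1 / (c - (x - t)) ≤ x := (hz.le_iff hxI).1 hx1
    have h2 : x < 1 / (c - x) := (h.2.2 x hxI).1 hx2
    have hcx : 0 < c - x := by linarith [hxI.2]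
    rw [lt_div_iff₀ hcx] at h2
    rw [div_le_iff₀ (by linarith)] at h1
    have hy : 1 / (c - (c - 1 / x)) = x := by simp
    have hy1 : c - 1 / x < x := by
      have : c - x < 1 / x := by
        rw [lt_div_iff₀ hx0]
        linarith
      linarith
    have hy2 : x - t ≤ c - 1 / x := by
      have : 1 / x ≤ c - (x - t) := by
        rw [div_le_iff₀ hx0]
        linarith
      linarith
    have hp : pull c t [false] (c - 1 / x) = x := hy
    refine ⟨c - 1 / x, c - 1 / x, hy2, hp.symm, ⟨⟨hy2, hy1⟩, trivial⟩, le_rfl, ?_, ?_, ?_, ?_, ?_⟩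
    · rw [hp]; exact hy1.le
    · rw [hp]; exact hy1
    · linarith [hxI.2]
    · exact fun y' h3 h4 => ⟨⟨h3, h4.trans hy1⟩, trivial⟩
    · exact fun y' h3 h4 => ⟨⟨h3, by rwa [hp] at h4⟩, trivial⟩

theorem ne_Vb (h : Inv c t V a b ω) : V ++ b ≠ [] := by simp [h.ne_V]

theorem omega_mem (hc : 3 ≤ c) (ht : 2 ≤ t) (h : Inv c t V a b ω) :
    ω ∈ Set.Ioc (0 : ℝ) (1 / 2) := by
  obtain ⟨r, h0, h1, h2, -⟩ := h.right_end
  rw [← h2]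
  exact pull_bounds hc ht h.ne_V h1.le

theorem zeta_append_lt (hc : 3 ≤ c) (ht : 2 ≤ t) (h : Inv c t V a b ω) :
    zeta c t (V ++ b) < ω := by
  have h0 := h.omega_mem hc ht
  obtain ⟨r, h1, h2, h3, h4, -⟩ := h.right_end
  rw [(zeta_spec hc ht h.ne_Vb).lt_iff ⟨h0.1.le, by linarith [h0.2]⟩, pull_append]
  have h5 : pull c t b (ω - t) < r := by
    conv_rhs => rw [← h4]
    exact pull_lt_pull hc ht b (by linarith [h0.2]) h2.le
  conv_rhs => rw [← h3]
  exact pull_lt_pull hc ht V h5 h2.le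

theorem eta_lt (hc : 3 ≤ c) (ht : 2 ≤ t) (h : Inv c t V a b ω) : eta c t V < ω := by
  have h0 := h.omega_mem hc ht
  obtain ⟨r, h1, h2, h3, h4, h5⟩ := h.right_end
  rw [(eta_spec hc ht h.ne_V).lt_iff ⟨h0.1.le, by linarith [h0.2]⟩]
  rw [h.pull_a r h2.le, h3] at h5
  conv_rhs => rw [← h3]
  exact pull_lt_pull hc ht V h5 h2.le

/-- If `η < x < ζ_{Vb}`, then the orbit of `x` continues by `a` after the word `V`; this is the
elementary move that describes the next step. -/
theorem move_a (hc : 3 ≤ c) (ht : 2 ≤ t) (h : Inv c t V a b ω) :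
    Inv c t V a (a ++ b) (zeta c t (V ++ b)) := by
  have hz := zeta_spec hc ht h.ne_Vb
  have hω := h.omega_mem hc ht
  have hzω := h.zeta_append_lt hc ht
  refine ⟨h.ne_V, h.ne_a, by simp [h.ne_a], ?_, h.pull_a, ?_, ?_⟩
  · intro y hy
    have h1 : pull c t V y ≤ 1 := pull_le_one hc ht V hy
    rw [pull_append, h.pull_ab y hy, ← pull_append]
  · have h1 : zeta c t (V ++ b) - t ≤ 1 := by linarith [hz.1.2]
    have h2 := pull_bounds hc ht h.ne_b h1
    have h3 : pull c t V (pull c t b (zeta c t (V ++ b) - t)) = zeta c t (V ++ b) := by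
      rw [← pull_append]
      exact hz.2.1
    have h4 : pull c t (a ++ b) (pull c t b (zeta c t (V ++ b) - t)) =
        pull c t b (zeta c t (V ++ b) - t) := by
      rw [h.pull_ab _ (by linarith), h3]
    refine ⟨_, h2.1, by linarith, h3, h4, ?_⟩
    conv_rhs => rw [← h4, pull_append]
    have h5 : zeta c t (V ++ b) - t < pull c t b (zeta c t (V ++ b) - t) := by
      linarith [hz.1.2]
    exact pull_lt_pull hc ht a (pull_lt_pull hc ht b h5 (by linarith))
      (pull_le_one hc ht b (by linarith))
  · intro x hx1 hx2
    obtain ⟨y, m, h1, h2, h3, h4, h5, h6, h7, h8, h9⟩ := h.orbit x hx1 (hx2.trans hzω)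
    have hx0 : 0 < x := (zeta_spec hc ht h.ne_V).1.1.trans_le hx1
    have hx : x < 1 := hx2.trans hz.1.2
    have hy : y ≤ 1 := h4.trans h7
    have h10 : x < pull c t (V ++ b) (x - t) := (hz.2.2 x ⟨hx0.le, hx.le⟩).1 hx2
    have h11 : y < pull c t b (x - t) := by
      rw [pull_append] at h10
      conv_lhs at h10 => rw [h2]
      rwa [pull_lt_iff hc ht V hy (pull_le_one hc ht b (by linarith))] at h10
    have h12 : pull c t (a ++ b) y = pull c t b (x - t) := by rw [h.pull_ab y hy, ← h2]
    refine ⟨y, y, h1, h2, h3, le_rfl, by rw [h12]; exact h11.le, by rw [h12]; exact h11, hy, ?_, ?_⟩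
    · intro y' h13 h14
      rw [adm_append]
      exact ⟨h9 _ (by linarith [(pull_bounds hc ht h.ne_b (h14.le.trans hy)).1])
        (pull_lt_pull hc ht b h14 hy), h8 y' h13 (h14.trans_le h4)⟩
    · intro y' h13 h14
      rw [h12] at h14
      exact h9 y' h13 (h14.trans_le (pull_le_pull hc ht b h1 hy))

/-- If `ζ_{Vb} ≤ x < ω`, then the orbit of `x` continues by `b` after the word `V`; this is the
elementary move that describes the next step. -/
theorem move_b (hc : 3 ≤ c) (ht : 2 ≤ t) (h : Inv c t V a b ω) :
    Inv c t (V ++ b) (a ++ b) b ω := by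
  have hz := zeta_spec hc ht h.ne_Vb
  have hω := h.omega_mem hc ht
  have hη := zeta_lt_eta hc ht h.ne_V
  refine ⟨h.ne_Vb, by simp [h.ne_a], h.ne_b, ?_, ?_, ?_, ?_⟩
  · intro y hy
    rw [pull_append, h.pull_ab _ (pull_le_one hc ht b hy), ← pull_append V]
  · intro y hy
    rw [pull_append, h.pull_a _ (pull_le_one hc ht b hy), ← pull_append V]
  · obtain ⟨r, h1, h2, h3, h4, h5⟩ := h.right_end
    exact ⟨r, h1, h2, by rw [pull_append, h4, h3], h4, by rwa [pull_append, h4]⟩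
  · intro x hx1 hx2
    have hx0 : 0 < x := hz.1.1.trans_le hx1
    have hx : x < 1 := by linarith [hω.2]
    have h10 : pull c t (V ++ b) (x - t) ≤ x := (hz.le_iff ⟨hx0.le, hx.le⟩).1 hx1
    -- `V` can be followed by `b` only to the right of `ζ_V`, as `pull b` is positive
    have hV : zeta c t V ≤ x := by
      rw [(zeta_spec hc ht h.ne_V).le_iff ⟨hx0.le, hx.le⟩]
      refine le_trans ?_ h10
      rw [pull_append]
      have := pull_bounds hc ht h.ne_b (y := x - t) (by linarith)
      exact pull_le_pull hc ht V (by linarith) (by linarith)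
    obtain ⟨y, m, h1, h2, h3, h4, h5, h6, h7, h8, h9⟩ := h.orbit x hV hx2
    have hy : y ≤ 1 := h4.trans h7
    have h11 : pull c t b (x - t) ≤ y := by
      rw [pull_append] at h10
      conv_rhs at h10 => rw [h2]
      rwa [pull_le_iff hc ht V (pull_le_one hc ht b (by linarith)) hy] at h10
    obtain ⟨z, ⟨hz1, hz2⟩, hz3⟩ : y ∈ pull c t b '' Set.Icc (x - t) m :=
      intermediate_value_Icc (by linarith)
        ((continuousOn_pull hc ht b).mono fun z hz => hz.2.trans h7) ⟨h11, h6.le⟩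
    have hzm : z < m := by
      refine lt_of_le_of_ne hz2 fun h12 => ?_
      rw [← hz3, h12] at h6
      exact lt_irrefl _ h6
    refine ⟨z, m, hz1, by rw [pull_append, hz3]; exact h2, ?_, hz2, h5, hzm.trans_le h5, h7, h8, ?_⟩
    · rw [adm_append, hz3]
      exact ⟨h3, h8 z hz1 hzm⟩
    · intro y' h13 h14
      rw [hz3] at h14
      rw [adm_append]
      exact ⟨h9 _ (by linarith [(pull_bounds hc ht h.ne_b (h14.le.trans hy)).1])
        (pull_lt_pull hc ht b h14 hy), h8 y' h13 (h14.trans_le h4)⟩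

/-- The right end of the range of the points with digits `V a^q b`. -/
noncomputable def childEnd (c t : ℝ) (V a b : List Bool) (ω : ℝ) : ℕ → ℝ
  | 0 => ω
  | q + 1 => zeta c t (V ++ (bpow a q ++ b))

theorem iterate_a (hc : 3 ≤ c) (ht : 2 ≤ t) (h : Inv c t V a b ω) (q : ℕ) :
    Inv c t V a (bpow a q ++ b) (childEnd c t V a b ω q) := by
  induction q with
  | zero => exact h
  | succ q ih =>
    have := ih.move_a hc ht
    rwa [← List.append_assoc, ← bpow_succ] at this

theorem child (hc : 3 ≤ c) (ht : 2 ≤ t) (h : Inv c t V a b ω) (q : ℕ) :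
    Inv c t (V ++ (bpow a q ++ b)) (bpow a (q + 1) ++ b) (bpow a q ++ b)
      (childEnd c t V a b ω q) := by
  have := (h.iterate_a hc ht q).move_b hc ht
  rwa [← List.append_assoc a, ← bpow_succ] at this

theorem eta_lt_zeta_child (hc : 3 ≤ c) (ht : 2 ≤ t) (h : Inv c t V a b ω) (q : ℕ) :
    eta c t V < zeta c t (V ++ (bpow a q ++ b)) :=
  (h.iterate_a hc ht (q + 1)).eta_lt hc ht

theorem cyl (h : Inv c t V a b ω) {x : ℝ} (h1 : zeta c t V ≤ x) (h2 : x < ω) : Cyl c t V x := by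
  obtain ⟨y, m, -, h3, h4, -⟩ := h.orbit x h1 h2
  exact ⟨y, h3, h4⟩

/-- The left ends of the ranges of the points with digits `V a^q b` accumulate at `η`: from a point
above the fixed point of `pull a`, the iterates of `pull a` descend below it. -/
theorem exists_zeta_child_le (hc : 3 ≤ c) (ht : 2 ≤ t) (h : Inv c t V a b ω) {x : ℝ}
    (hx : eta c t V < x) (hx' : x < ω) : ∃ q, zeta c t (V ++ (bpow a q ++ b)) ≤ x := by
  have hη := eta_spec hc ht h.ne_V
  have hω := h.omega_mem hc ht
  have hxI : x ∈ Set.Icc (0 : ℝ) 1 := ⟨(hη.1.1.trans hx).le, by linarith [hω.2]⟩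
  obtain ⟨y, m, h1, h2, -, h4, -, -, h7, -⟩ :=
    h.orbit x ((zeta_lt_eta hc ht h.ne_V).le.trans hx.le) hx'
  have hy : y ≤ 1 := h4.trans h7
  have hay : pull c t a y < y := by
    rw [h.pull_a y hy, ← h2]
    have := (hη.lt_iff hxI).1 hx
    conv_rhs at this => rw [h2]
    rwa [pull_lt_iff hc ht V (div_one_add_mul_le ht hxI.1).2 hy] at this
  have hz : pull c t b (x - t) ≤ 1 := pull_le_one hc ht b (by linarith [hxI.2])
  have key : ∃ q, pull c t (bpow a q) (pull c t b (x - t)) ≤ y := by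
    by_contra! hcon
    have hiter : ∀ q : ℕ, pull c t (bpow a q) (pull c t b (x - t)) ≤
        1 - q * (y - pull c t a y) := by
      intro q
      induction q with
      | zero => simpa [pull] using hz
      | succ q ih =>
        have h3 := pull_sub_le hc ht h.ne_a (hcon q) (pull_le_one hc ht _ hz)
        rw [bpow_succ, pull_append]
        push_cast
        linarith [hcon q]
    obtain ⟨q, hq⟩ := exists_nat_gt ((1 - y) / (y - pull c t a y))
    rw [div_lt_iff₀ (by linarith)] at hq
    linarith [hiter q, hcon q]
  obtain ⟨q, hq⟩ := key
  refine ⟨q, ?_⟩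
  rw [(zeta_spec hc ht (by simp [h.ne_V])).le_iff hxI, pull_append, pull_append]
  conv_rhs => rw [h2]
  exact pull_le_pull hc ht V hq hy

/-- Both ends of the range of the points with digits `V` are images under `pull V` of points less
than `1 + t` apart. -/
theorem omega_sub_zeta_le (hc : 3 ≤ c) (ht : 2 ≤ t) (h : Inv c t V a b ω) :
    ω - zeta c t V ≤ (1 + t) / 4 ^ V.length := by
  obtain ⟨r, h1, h2, h3, -⟩ := h.right_end
  have hz := zeta_spec hc ht h.ne_V
  have h4 := (pull_contract hc ht V (y := zeta c t V - t) (y' := r)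
    (by linarith [hz.1.2]) h2.le).2
  rw [h3] at h4
  have h5 : pull c t V (zeta c t V - t) = zeta c t V := hz.2.1
  rw [h5] at h4
  refine h4.trans ?_
  gcongr
  linarith [hz.1.1]

/-- The range of the points with digits `V a^q b` lies to the left of its right end if this holds
for `V`: to the right of that end, the digits are `V a^j b` with `j < q`, and the words `a^j b` and
`a^q b` differ. The hypotheses `hb` and `ha` say at which letter `b` differs from `a^i b`. -/
theorem lt_childEnd (hc : 3 ≤ c) (ht : 2 ≤ t) (h : Inv c t V a b ω)
    {p s e : List Bool} (hb : b = p ++ false :: s) (ha : a ++ p = p ++ true :: e)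
    {x : ℝ} (hxω : x < ω) (q : ℕ) (hx : Cyl c t (V ++ (bpow a q ++ b)) x) :
    x < childEnd c t V a b ω q := by
  have hclash : ∀ i : ℕ, ∃ e', bpow a (i + 1) ++ p = p ++ true :: e' := by
    intro i
    induction i with
    | zero => exact ⟨e, by simpa [bpow] using ha⟩
    | succ i ih =>
      obtain ⟨e', he'⟩ := ih
      refine ⟨e ++ true :: e', ?_⟩
      rw [bpow_succ, List.append_assoc, he', ← List.append_assoc, ha]
      simp
  have hadd : ∀ i j, bpow a (j + i) = bpow a j ++ bpow a i := by
    intro i j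
    rw [bpow, List.replicate_add, List.flatten_append, bpow, bpow]
  have hall : ∀ j ≤ q, x < childEnd c t V a b ω j := by
    intro j hj
    induction j with
    | zero => exact hxω
    | succ j ih =>
      by_contra! hcon
      have h1 := ((h.iterate_a hc ht j).move_b hc ht).cyl hcon (ih (by omega))
      obtain ⟨i, rfl⟩ : ∃ i, q = j + (i + 1) := ⟨q - (j + 1), by omega⟩
      obtain ⟨e', he'⟩ := hclash i
      refine not_cyl_of_clash (V ++ bpow a j ++ p) s (e' ++ false :: s) (x := x) (c := c) (t := t)
        ?_ ?_
      · simpa [hb] using h1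
      · have : V ++ (bpow a (j + (i + 1)) ++ b) =
            V ++ bpow a j ++ p ++ true :: (e' ++ false :: s) := by
          rw [hadd, hb]
          simp only [List.append_assoc]
          rw [← List.append_assoc (bpow a (i + 1)), he']
          simp
        rwa [this] at hx
  exact hall q le_rfl

end Inv

end Words

/-! ### Cantor sets from trees of intervals -/

/-- A tree of intervals with gaps: the nodes are the finite sequences of natural numbers, the child
`q :: l` of `l` being written at the front. The interval of a node `l ≠ []` is `[Z l, O l)`, its
gap is `[Z l, E l)`, and the intervals of the children fill `(E l, O l)` from right to left. The
interval of the root is `(E [], O [])`; it has no gap. -/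
structure GapTree (Z E O : List ℕ → ℝ) : Prop where
  gap : ∀ l, l ≠ [] → Z l < E l
  rest : ∀ l, E l < O l
  first : ∀ l, O (0 :: l) = O l
  next : ∀ q l, O ((q + 1) :: l) = Z (q :: l)
  above : ∀ q l, E l < Z (q :: l)
  fill : ∀ l x, E l < x → x < O l → ∃ q, Z (q :: l) ≤ x
  small : ∀ ε > 0, ∃ N, ∀ l : List ℕ, N ≤ l.length → O l - Z l < ε

namespace GapTree

variable {Z E O : List ℕ → ℝ}

theorem lt (h : GapTree Z E O) {l : List ℕ} (hl : l ≠ []) : Z l < O l :=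
  (h.gap l hl).trans (h.rest l)

theorem end_le (h : GapTree Z E O) (q : ℕ) (l : List ℕ) : O (q :: l) ≤ O l := by
  induction q with
  | zero => exact (h.first l).le
  | succ q ih =>
    rw [h.next]
    exact (h.lt (by simp)).le.trans ih

theorem start_antitone (h : GapTree Z E O) (l : List ℕ) : Antitone fun q => Z (q :: l) := by
  apply antitone_nat_of_succ_le
  intro q
  exact (h.lt (l := (q + 1) :: l) (by simp)).le.trans_eq (h.next q l)

theorem end_le_start (h : GapTree Z E O) {q q' : ℕ} (hq : q < q') (l : List ℕ) :
    O (q' :: l) ≤ Z (q :: l) := by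
  obtain ⟨j, rfl⟩ : ∃ j, q' = j + 1 := ⟨q' - 1, by omega⟩
  rw [h.next]
  exact h.start_antitone l (by omega)

theorem child_unique (h : GapTree Z E O) {q q' : ℕ} {l : List ℕ} {x : ℝ}
    (h1 : x ∈ Set.Ico (Z (q :: l)) (O (q :: l))) (h2 : x ∈ Set.Ico (Z (q' :: l)) (O (q' :: l))) :
    q = q' := by
  rcases lt_trichotomy q q' with h3 | h3 | h3
  · linarith [h.end_le_start h3 l, h1.1, h2.2]
  · exact h3
  · linarith [h.end_le_start h3 l, h2.1, h1.2]

theorem child_subset (h : GapTree Z E O) {q : ℕ} {l : List ℕ} {x : ℝ}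
    (hx : x ∈ Set.Ico (Z (q :: l)) (O (q :: l))) : x ∈ Set.Ioo (E l) (O l) :=
  ⟨(h.above q l).trans_le hx.1, hx.2.trans_le (h.end_le q l)⟩

theorem exists_child (h : GapTree Z E O) {l : List ℕ} {x : ℝ} (hx : x ∈ Set.Ioo (E l) (O l)) :
    ∃ q, x ∈ Set.Ico (Z (q :: l)) (O (q :: l)) := by
  classical
  have hex := h.fill l x hx.1 hx.2
  refine ⟨Nat.find hex, Nat.find_spec hex, ?_⟩
  rcases hq : Nat.find hex with _ | q
  · rw [h.first]
    exact hx.2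
  · rw [h.next]
    exact not_le.1 (Nat.find_min hex (by omega : q < Nat.find hex))

theorem Ico_subset_Ioo (h : GapTree Z E O) {l : List ℕ} (hl : l ≠ []) {x : ℝ}
    (hx : x ∈ Set.Ico (E l) (O l)) : x ∈ Set.Ico (Z l) (O l) :=
  ⟨(h.gap l hl).le.trans hx.1, hx.2⟩

theorem subset_of_append (h : GapTree Z E O) {u l : List ℕ} (hu : u ≠ []) {x : ℝ}
    (hx : x ∈ Set.Ico (Z (u ++ l)) (O (u ++ l))) : x ∈ Set.Ioo (E l) (O l) := by
  induction u with
  | nil => exact absurd rfl hu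
  | cons q u ih =>
    have h1 := h.child_subset hx
    rcases eq_or_ne u [] with rfl | h2
    · exact h1
    · exact ih h2 (h.Ico_subset_Ioo (by simp [h2]) ⟨h1.1.le, h1.2⟩)

theorem eq_of_length_eq (h : GapTree Z E O) {l l' : List ℕ} (hlen : l.length = l'.length)
    (hl : l ≠ []) {x : ℝ} (hx : x ∈ Set.Ico (Z l) (O l)) (hx' : x ∈ Set.Ico (Z l') (O l')) :
    l = l' := by
  induction l generalizing l' with
  | nil => exact absurd rfl hl
  | cons q l ih =>
    cases l' with
    | nil => simp at hlen
    | cons q' l' =>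
      have hlen' : l.length = l'.length := by simpa using hlen
      have h1 := h.child_subset hx
      have h2 := h.child_subset hx'
      have hll : l = l' := by
        rcases eq_or_ne l [] with rfl | h3
        · exact (List.length_eq_zero_iff.1 hlen'.symm).symm
        · have h4 : l' ≠ [] := by
            rintro rfl
            exact h3 (List.length_eq_zero_iff.1 hlen')
          exact ih hlen' h3 (h.Ico_subset_Ioo h3 ⟨h1.1.le, h1.2⟩)
            (h.Ico_subset_Ioo h4 ⟨h2.1.le, h2.2⟩)
      subst hll
      rw [h.child_unique hx hx']

/-- Nodes whose intervals have a common point are on one branch of the tree. -/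
theorem suffix_of_mem (h : GapTree Z E O) {l l' : List ℕ} (hl : l ≠ []) {x : ℝ}
    (hlen : l.length ≤ l'.length)
    (hx : x ∈ Set.Ico (Z l) (O l)) (hx' : x ∈ Set.Ico (Z l') (O l')) :
    l = l' ∨ x ∈ Set.Ioo (E l) (O l) := by
  obtain ⟨u, s, rfl, hs⟩ : ∃ u s, l' = u ++ s ∧ s.length = l.length :=
    ⟨l'.take (l'.length - l.length), l'.drop (l'.length - l.length),
      (List.take_append_drop _ _).symm, by simp; omega⟩
  rcases eq_or_ne u [] with rfl | hu
  · exact Or.inl (h.eq_of_length_eq hs.symm hl hx hx')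
  · have h1 := h.subset_of_append hu hx'
    have h2 : s ≠ [] := by
      rintro rfl
      exact hl (List.length_eq_zero_iff.1 hs.symm)
    have h3 := h.eq_of_length_eq hs.symm hl hx (h.Ico_subset_Ioo h2 ⟨h1.1.le, h1.2⟩)
    subst h3
    exact Or.inr h1

/-- The right end of a gap lies in no gap. -/
theorem E_notMem (h : GapTree Z E O) {l l' : List ℕ} (hl : l ≠ []) (hl' : l' ≠ []) :
    E l ∉ Set.Ico (Z l') (E l') := by
  intro hx
  have h1 := h.Ico_subset_Ioo hl ⟨le_rfl, h.rest l⟩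
  have h2 : E l ∈ Set.Ico (Z l') (O l') := ⟨hx.1, hx.2.trans (h.rest l')⟩
  rcases le_total l.length l'.length with h3 | h3
  · rcases h.suffix_of_mem hl h3 h1 h2 with rfl | h4
    · exact lt_irrefl _ hx.2
    · exact lt_irrefl _ h4.1
  · rcases h.suffix_of_mem hl' h3 h2 h1 with rfl | h4
    · exact lt_irrefl _ hx.2
    · exact lt_irrefl _ (hx.2.trans h4.1)

theorem mem_root (h : GapTree Z E O) {l : List ℕ} (hl : l ≠ []) {x : ℝ}
    (hx : x ∈ Set.Ico (Z l) (O l)) : x ∈ Set.Ioo (E []) (O []) := by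
  have := h.subset_of_append (u := l) (l := []) hl (x := x)
  rw [List.append_nil] at this
  exact this hx

/-- Every point outside the gaps is a limit of right ends of gaps. -/
theorem exists_E_near (h : GapTree Z E O) {x : ℝ} (hx : x ∈ Set.Icc (E []) (O []))
    (hgap : ∀ l, l ≠ [] → x ∉ Set.Ioo (Z l) (E l)) {ε : ℝ} (hε : 0 < ε) :
    ∃ l, l ≠ [] ∧ E l ≠ x ∧ |E l - x| < ε := by
  by_cases h1 : ∃ l, x = O l
  · -- the nodes `0 ⋯ 0 l` have the same right end as `l`
    obtain ⟨l, rfl⟩ := h1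
    obtain ⟨N, hN⟩ := h.small ε hε
    have hO : ∀ j, O (List.replicate j 0 ++ l) = O l := by
      intro j
      induction j with
      | zero => rfl
      | succ j ih => rw [List.replicate_succ, List.cons_append, h.first, ih]
    have hne : List.replicate (N + 1) 0 ++ l ≠ [] := by simp [List.replicate_succ]
    have h2 := h.gap _ hne
    have h3 := h.rest (List.replicate (N + 1) 0 ++ l)
    have h4 := hN (List.replicate (N + 1) 0 ++ l) (by simp; omega)
    rw [hO] at h3 h4
    exact ⟨_, hne, h3.ne, by rw [abs_lt]; constructor <;> linarith⟩
  by_cases h2 : ∃ l, x = E l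
  · obtain ⟨l, rfl⟩ := h2
    have h3 := h.rest l
    obtain ⟨q, hq⟩ := h.fill l (min (E l + ε / 2) ((E l + O l) / 2))
      (lt_min (by linarith) (by linarith)) ((min_le_right _ _).trans_lt (by linarith))
    have h4 := hq.trans (min_le_left _ _)
    have h5 := h.rest ((q + 1) :: l)
    have h6 := h.gap ((q + 1) :: l) (by simp)
    have h7 := h.above (q + 1) l
    rw [h.next] at h5
    exact ⟨(q + 1) :: l, by simp, by linarith, by rw [abs_lt]; constructor <;> linarith⟩
  · push Not at h1 h2
    have key : ∀ N, ∃ l : List ℕ, l.length = N ∧ x ∈ Set.Ioo (E l) (O l) := by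
      intro N
      induction N with
      | zero => exact ⟨[], rfl, lt_of_le_of_ne hx.1 (h2 []).symm, lt_of_le_of_ne hx.2 (h1 [])⟩
      | succ N ih =>
        obtain ⟨l, hl, hxl⟩ := ih
        obtain ⟨q, hq⟩ := h.exists_child hxl
        refine ⟨q :: l, by simp [hl], ?_, hq.2⟩
        have h3 : x ≠ Z (q :: l) := by
          rw [← h.next]
          exact h1 _
        have h4 := hgap (q :: l) (by simp)
        by_contra! h5
        exact h4 ⟨lt_of_le_of_ne hq.1 h3.symm, lt_of_le_of_ne h5 (h2 _)⟩
    obtain ⟨N, hN⟩ := h.small ε hε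
    obtain ⟨l, hl, hxl⟩ := key (N + 1)
    have hne : l ≠ [] := by
      rintro rfl
      simp at hl
    have h3 := hN l (by omega)
    have h4 := h.gap l hne
    exact ⟨l, hne, (h2 l).symm, by rw [abs_lt]; constructor <;> linarith [hxl.1, hxl.2]⟩

theorem E_mem (h : GapTree Z E O) {l : List ℕ} (hl : l ≠ []) :
    E l ∈ Set.Ioo (E []) (O []) \ ⋃ l ∈ {l | l ≠ []}, Set.Ico (Z l) (E l) := by
  refine ⟨h.mem_root hl (h.Ico_subset_Ioo hl ⟨le_rfl, h.rest l⟩), ?_⟩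
  simp only [Set.mem_iUnion, not_exists]
  exact fun l' hl' => h.E_notMem hl hl'

theorem sdiff_subset :
    Set.Ioo (E []) (O []) \ ⋃ l ∈ {l | l ≠ []}, Set.Ico (Z l) (E l) ⊆
      Set.Icc (E []) (O []) \ ⋃ l ∈ {l | l ≠ []}, Set.Ioo (Z l) (E l) :=
  Set.sdiff_subset_sdiff Set.Ioo_subset_Icc_self
    (Set.iUnion₂_mono fun _ _ => Set.Ioo_subset_Ico_self)

theorem isClosed_diff :
    IsClosed (Set.Icc (E []) (O []) \ ⋃ l ∈ {l | l ≠ []}, Set.Ioo (Z l) (E l)) :=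
  isClosed_Icc.sdiff (isOpen_biUnion fun _ _ => isOpen_Ioo)

theorem exists_E_near' (h : GapTree Z E O) {x : ℝ}
    (hx : x ∈ Set.Icc (E []) (O []) \ ⋃ l ∈ {l | l ≠ []}, Set.Ioo (Z l) (E l)) {ε : ℝ}
    (hε : 0 < ε) : ∃ l, l ≠ [] ∧ E l ≠ x ∧ |E l - x| < ε := by
  refine h.exists_E_near hx.1 (fun l hl hl' => hx.2 ?_) hε
  exact Set.mem_biUnion (show l ∈ {l | l ≠ []} from hl) hl'

theorem closure_diff (h : GapTree Z E O) :
    closure (Set.Ioo (E []) (O []) \ ⋃ l ∈ {l | l ≠ []}, Set.Ico (Z l) (E l)) =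
      Set.Icc (E []) (O []) \ ⋃ l ∈ {l | l ≠ []}, Set.Ioo (Z l) (E l) := by
  apply Set.Subset.antisymm
  · exact closure_minimal sdiff_subset isClosed_diff
  · intro x hx
    rw [Metric.mem_closure_iff]
    intro ε hε
    obtain ⟨l, hl, -, h1⟩ := h.exists_E_near' hx hε
    exact ⟨E l, h.E_mem hl, by rwa [dist_comm, Real.dist_eq]⟩

theorem isCantorSet (h : GapTree Z E O) :
    IsCantorSet (Set.Icc (E []) (O []) \ ⋃ l ∈ {l | l ≠ []}, Set.Ioo (Z l) (E l)) := by
  refine ⟨⟨E [0], sdiff_subset (h.E_mem (by simp))⟩,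
    isCompact_Icc.of_isClosed_subset isClosed_diff Set.sdiff_subset, ⟨isClosed_diff, ?_⟩, ?_⟩
  · intro x hx
    rw [accPt_iff_nhds]
    intro U hU
    obtain ⟨ε, hε, hεU⟩ := Metric.mem_nhds_iff.1 hU
    obtain ⟨l, hl, h1, h2⟩ := h.exists_E_near' hx hε
    exact ⟨E l, ⟨hεU (by rwa [Metric.mem_ball, Real.dist_eq]), sdiff_subset (h.E_mem hl)⟩, h1⟩
  · intro S hS hSc x hx y hy
    -- an interval between two points of `S` would contain the right end of a gap
    wlog hxy : x < y generalizing x y hx hy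
    · rcases eq_or_lt_of_not_gt hxy with h1 | h1
      · exact h1.symm
      · exact (this hy hx h1).symm
    exfalso
    have hsub := hSc.ordConnected.out hx hy
    have hmid : (x + y) / 2 ∈ S := hsub ⟨by linarith, by linarith⟩
    obtain ⟨l, hl, -, h2⟩ := h.exists_E_near' (hS hmid) (ε := (y - x) / 2) (by linarith)
    rw [abs_lt] at h2
    have h3 := h.gap l hl
    have h4 : (max x (Z l) + E l) / 2 ∈ Set.Ioo (max x (Z l)) (E l) := by
      have : max x (Z l) < E l := max_lt (by linarith) h3
      constructor <;> linarith
    have h5 : (max x (Z l) + E l) / 2 ∈ S :=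
      hsub ⟨(le_max_left _ _).trans h4.1.le, by linarith [h4.2]⟩
    exact (hS h5).2 (Set.mem_biUnion (show l ∈ {l | l ≠ []} from hl)
      ⟨(le_max_right _ _).trans_lt h4.1, h4.2⟩)

end GapTree

/-! ### The tree of binary words -/

section Tree


/-- The words `V`, `a = V'`, `b = V''` at a node of the tree. The one-element sequence `[j]` stands
for the word `1` with `k = j + 1`, and `q :: l` for the child `V a^q b` of the node `l`. The value
at the root `[]` is not used. -/
def triple : List ℕ → List Bool × List Bool × List Bool
  | [] => ([], [], [])
  | [_] => ([false], [true], [false])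
  | q :: j :: l =>
    ((triple (j :: l)).1 ++ (bpow (triple (j :: l)).2.1 q ++ (triple (j :: l)).2.2),
      bpow (triple (j :: l)).2.1 (q + 1) ++ (triple (j :: l)).2.2,
      bpow (triple (j :: l)).2.1 q ++ (triple (j :: l)).2.2)

/-- The integer `k` to which a node other than the root belongs. -/
def baseDigit : List ℕ → ℕ
  | [] => 0
  | [j] => j + 1
  | _ :: j :: l => baseDigit (j :: l)

/-- The constant `k t + 1` in the inverse branches at a node. -/
noncomputable def shiftConst (t : ℝ) (l : List ℕ) : ℝ := baseDigit l * t + 1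

/-- The left end of the interval of a node. -/
noncomputable def leftEnd (t : ℝ) (l : List ℕ) : ℝ := zeta (shiftConst t l) t (triple l).1

/-- The right end of the gap of a node; at the root, the left end `0` of the whole interval. -/
noncomputable def gapEnd (t : ℝ) : List ℕ → ℝ
  | [] => 0
  | j :: l => eta (shiftConst t (j :: l)) t (triple (j :: l)).1

/-- The right end of the interval of a node. -/
noncomputable def rightEnd (t : ℝ) : List ℕ → ℝ
  | [] => fixedPt (1 * t + 1) t
  | [j] => fixedPt (shiftConst t [j]) t
  | q :: j :: l => Inv.childEnd (shiftConst t (j :: l)) t (triple (j :: l)).1 (triple (j :: l)).2.1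
      (triple (j :: l)).2.2 (rightEnd t (j :: l)) q

theorem one_le_baseDigit {l : List ℕ} (hl : l ≠ []) : 1 ≤ baseDigit l := by
  induction l with
  | nil => exact absurd rfl hl
  | cons q l ih =>
    cases l with
    | nil => simp [baseDigit]
    | cons j l => exact ih (by simp)

variable {t : ℝ}

theorem three_le_mul_add_one (ht : 2 ≤ t) {k : ℕ} (hk : 1 ≤ k) : 3 ≤ k * t + 1 := by
  have : (1 : ℝ) ≤ k := by exact_mod_cast hk
  nlinarith

theorem three_le_shiftConst (ht : 2 ≤ t) {l : List ℕ} (hl : l ≠ []) : 3 ≤ shiftConst t l :=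
  three_le_mul_add_one ht (one_le_baseDigit hl)

theorem inv_triple (ht : 2 ≤ t) {l : List ℕ} (hl : l ≠ []) :
    Inv (shiftConst t l) t (triple l).1 (triple l).2.1 (triple l).2.2 (rightEnd t l) := by
  induction l with
  | nil => exact absurd rfl hl
  | cons q l ih =>
    cases l with
    | nil => exact Inv.base (three_le_shiftConst ht hl) ht
    | cons j l => exact (ih (by simp)).child (three_le_shiftConst ht (by simp)) ht q

/-- The words `V'` and `V''` determine at which letter a power of `V'` and `V''` differ. -/
theorem exists_clash {l : List ℕ} (hl : l ≠ []) : ∃ p s e : List Bool,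
    (triple l).2.2 = p ++ false :: s ∧ (triple l).2.1 ++ p = p ++ true :: e := by
  induction l with
  | nil => exact absurd rfl hl
  | cons q l ih =>
    cases l with
    | nil => exact ⟨[], [], [], rfl, rfl⟩
    | cons j l =>
      obtain ⟨p, s, e, hb, ha⟩ := ih (by simp)
      have h1 : ∀ r : ℕ, bpow (triple (j :: l)).2.1 r ++ (triple (j :: l)).2.2 =
          (bpow (triple (j :: l)).2.1 r ++ p) ++ false :: s := by
        intro r
        rw [hb, List.append_assoc]
      have h2 : ∀ r : ℕ, bpow (triple (j :: l)).2.1 (r + 1) ++ p =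
          (bpow (triple (j :: l)).2.1 r ++ p) ++ true :: e := by
        intro r
        rw [bpow_succ', List.append_assoc, ha]
        simp
      refine ⟨bpow (triple (j :: l)).2.1 q ++ p, s,
        e ++ false :: (s ++ (bpow (triple (j :: l)).2.1 q ++ p)), h1 q, ?_⟩
      have h3 : bpow (triple (j :: l)).2.1 (q + 1) ++ (triple (j :: l)).2.2 =
          (bpow (triple (j :: l)).2.1 q ++ p) ++ true :: (e ++ false :: s) := by
        rw [hb, ← List.append_assoc, h2]
        simp
      change (bpow (triple (j :: l)).2.1 (q + 1) ++ (triple (j :: l)).2.2) ++ _ = _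
      rw [h3]
      simp

/-- The points of `[0, 1]` whose orbit begins with the word of a node form an interval. -/
theorem cyl_triple_iff (ht : 2 ≤ t) {l : List ℕ} (hl : l ≠ []) {x : ℝ}
    (hx : x ∈ Set.Icc (0 : ℝ) 1) :
    Cyl (shiftConst t l) t (triple l).1 x ↔ x ∈ Set.Ico (leftEnd t l) (rightEnd t l) := by
  constructor
  · intro h
    refine ⟨h.zeta_le (three_le_shiftConst ht hl) ht (inv_triple ht hl).ne_V hx, ?_⟩
    induction l with
    | nil => exact absurd rfl hl
    | cons q l ih =>
      cases l with
      | nil =>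
        have hc : 3 ≤ shiftConst t [q] := three_le_shiftConst ht hl
        have hf := fixedPt_spec hc ht
        obtain ⟨y, h1, h2⟩ := h
        have h3 := h2.mem_Ico (by simp [triple])
        change x < fixedPt (shiftConst t [q]) t
        rw [← not_le, hf.le_iff hx, not_le]
        conv_lhs => rw [h1]
        exact (branch_contract hc ht false h3.2 hx.2).1
      | cons j l =>
        obtain ⟨p, s, e, hb, ha⟩ := exists_clash (l := j :: l) (by simp)
        have h1 : Cyl (shiftConst t (j :: l)) t (triple (j :: l)).1 x := Cyl.of_append h
        exact (inv_triple ht (l := j :: l) (by simp)).lt_childEnd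
          (three_le_shiftConst ht (by simp)) ht hb ha (ih (by simp) h1) q h
  · exact fun h => (inv_triple ht hl).cyl h.1 h.2

theorem length_le_length_triple {l : List ℕ} (hl : l ≠ []) : l.length ≤ (triple l).1.length := by
  induction l with
  | nil => exact absurd rfl hl
  | cons q l ih =>
    cases l with
    | nil => simp [triple]
    | cons j l =>
      have h1 := ih (by simp)
      have h2 : (triple (j :: l)).2.2 ≠ [] :=
        (inv_triple (t := 2) le_rfl (l := j :: l) (by simp)).ne_b
      have h3 := List.length_pos_iff.2 h2
      simp only [triple, List.length_append, List.length_cons] at *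
      omega

/-- The intervals for the successive values of `k` are adjacent. -/
theorem fixedPt_succ_eq_zeta (ht : 2 ≤ t) {k : ℕ} (hk : 1 ≤ k) :
    fixedPt (((k + 1 : ℕ) : ℝ) * t + 1) t = zeta (k * t + 1) t [false] := by
  have h1 := fixedPt_spec (three_le_mul_add_one ht (Nat.le_add_left 1 k)) ht
  rw [(zeta_spec (three_le_mul_add_one ht hk) ht (by simp)).eq_iff ⟨h1.1.1.le, h1.1.2.le⟩]
  conv_rhs => rw [← h1.2.1]
  simp only [pull, branch]
  push_cast
  congr 1
  ring

theorem gapTree (ht : 2 ≤ t) : GapTree (leftEnd t) (gapEnd t) (rightEnd t) where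
  gap l hl := by
    cases l with
    | nil => exact absurd rfl hl
    | cons j l => exact zeta_lt_eta (three_le_shiftConst ht hl) ht (inv_triple ht hl).ne_V
  rest l := by
    cases l with
    | nil => exact (fixedPt_spec (by linarith) ht).1.1
    | cons j l => exact (inv_triple ht (by simp)).eta_lt (three_le_shiftConst ht (by simp)) ht
  first l := by
    cases l with
    | nil => simp [rightEnd, shiftConst, baseDigit]
    | cons j l => rfl
  next q l := by
    cases l with
    | nil => exact fixedPt_succ_eq_zeta ht (Nat.le_add_left 1 q)
    | cons j l => rfl
  above q l := by
    cases l with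
    | nil =>
      exact (zeta_spec (three_le_shiftConst ht (by simp)) ht (inv_triple ht (by simp)).ne_V).1.1
    | cons j l =>
      exact (inv_triple ht (by simp)).eta_lt_zeta_child (three_le_shiftConst ht (by simp)) ht q
  fill l x hx hx' := by
    cases l with
    | nil =>
      obtain ⟨q, hq⟩ := exists_nat_one_div_lt (show (0 : ℝ) < x from hx)
      refine ⟨q, le_trans ?_ hq.le⟩
      have hc : 3 ≤ shiftConst t [q] := three_le_shiftConst ht (by simp)
      have h1 := zeta_spec hc ht (w := [false]) (by simp)
      change zeta (shiftConst t [q]) t [false] ≤ _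
      rw [← h1.2.1]
      simp only [pull, branch, shiftConst, baseDigit]
      push_cast
      apply one_div_le_one_div_of_le (by positivity)
      have := h1.1.2
      simp only [shiftConst, baseDigit] at this
      push_cast at this
      have hq0 : (0 : ℝ) ≤ q := Nat.cast_nonneg q
      nlinarith
    | cons j l =>
      exact (inv_triple ht (by simp)).exists_zeta_child_le (three_le_shiftConst ht (by simp)) ht
        hx hx'
  small ε hε := by
    obtain ⟨N, hN⟩ := exists_pow_lt_of_lt_one (show 0 < ε / (1 + t) by positivity)
      (show (1 / 4 : ℝ) < 1 by norm_num)
    refine ⟨N + 1, fun l hl => ?_⟩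
    have hne : l ≠ [] := by
      rintro rfl
      simp at hl
    refine ((inv_triple ht hne).omega_sub_zeta_le (three_le_shiftConst ht hne) ht).trans_lt ?_
    have h1 : (1 / 4 : ℝ) ^ (triple l).1.length ≤ (1 / 4) ^ N :=
      pow_le_pow_of_le_one (by norm_num) (by norm_num)
        (by have := length_le_length_triple hne; omega)
    have h2 := h1.trans_lt hN
    rw [lt_div_iff₀ (by linarith), one_div, inv_pow] at h2
    rw [div_eq_inv_mul]
    exact h2

theorem GapTree.div_const {Z E O : List ℕ → ℝ} (h : GapTree Z E O) {s : ℝ} (hs : 0 < s) :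
    GapTree (fun l => Z l / s) (fun l => E l / s) (fun l => O l / s) where
  gap l hl := div_lt_div_of_pos_right (h.gap l hl) hs
  rest l := div_lt_div_of_pos_right (h.rest l) hs
  first l := by rw [h.first]
  next q l := by rw [h.next]
  above q l := div_lt_div_of_pos_right (h.above q l) hs
  fill l x hx hx' := by
    rw [div_lt_iff₀ hs] at hx
    rw [lt_div_iff₀ hs] at hx'
    obtain ⟨q, hq⟩ := h.fill l (x * s) hx hx'
    exact ⟨q, by rwa [div_le_iff₀ hs]⟩
  small ε hε := by
    obtain ⟨N, hN⟩ := h.small (ε * s) (by positivity)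
    refine ⟨N, fun l hl => ?_⟩
    rw [← sub_div, div_lt_iff₀ hs]
    exact hN l hl

end Tree

/-! ### Words as binary words -/

/-- The binary word with given run lengths, the first run consisting of the letter `d`. -/
def expand (d : Bool) : List ℕ → List Bool
  | [] => []
  | c :: w => List.replicate c d ++ expand (!d) w

theorem expand_append (d : Bool) (u w : List ℕ) :
    (Even u.length → expand d (u ++ w) = expand d u ++ expand d w) ∧
      (Odd u.length → expand d (u ++ w) = expand d u ++ expand (!d) w) := by
  induction u generalizing d with
  | nil => simp [expand]
  | cons c u ih =>
    have := ih (!d)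
    simp only [Bool.not_not] at this
    constructor
    · intro h
      have h1 : Odd u.length := by
        rw [List.length_cons, Nat.even_add_one, Nat.not_even_iff_odd] at h
        exact h
      simp [expand, this.2 h1]
    · intro h
      have h1 : Even u.length := by
        rw [List.length_cons, Nat.odd_add_one, Nat.not_odd_iff_even] at h
        exact h
      simp [expand, this.1 h1]

theorem wpow_succ (w : List ℕ) (q : ℕ) : wpow w (q + 1) = w ++ wpow w q := by
  simp [wpow, List.replicate_succ]

theorem even_length_wpow {w : List ℕ} (h : Even w.length) (q : ℕ) :
    Even (wpow w q).length := by
  induction q with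
  | zero => simp [wpow]
  | succ q ih =>
    rw [wpow_succ, List.length_append]
    exact h.add ih

theorem expand_wpow (d : Bool) {w : List ℕ} (h : Even w.length) (q : ℕ) :
    expand d (wpow w q) = bpow (expand d w) q := by
  induction q with
  | zero => rfl
  | succ q ih => rw [wpow_succ, (expand_append d _ _).1 h, ih, bpow_succ]

theorem bpow_singleton (d : Bool) (q : ℕ) : bpow [d] q = List.replicate q d := by
  induction q with
  | zero => rfl
  | succ q ih => rw [bpow_succ, ih, List.replicate_succ]; rfl

/-- Passing from `v` to `v'` changes the first digit from `k` to `k + 1`. -/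
theorem expand_prime {c : ℕ} (hc : 1 ≤ c) (d : ℕ) (r : List ℕ) :
    expand true (prime (c :: d :: r)) = true :: (expand false (c :: d :: r)).tail := by
  obtain ⟨c, rfl⟩ : ∃ c', c = c' + 1 := ⟨c - 1, by omega⟩
  rcases c with _ | c
  · simp [prime, expand, List.replicate_succ]
  · simp [prime, expand, List.replicate_succ]

theorem even_length_prime {c : ℕ} (d : ℕ) (r : List ℕ) (h : Odd (c :: d :: r).length) :
    Even (prime (c :: d :: r)).length := by
  rcases eq_or_ne c 1 with rfl | hc
  · simp only [List.length_cons] at h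
    simp only [prime, List.length_cons]
    rw [Nat.odd_add_one, Nat.not_odd_iff_even] at h
    exact h
  · have : prime (c :: d :: r) = 1 :: (c - 1) :: d :: r := by
      rw [prime]
      · simp
      · exact fun _ _ h1 _ => hc h1
    rw [this, List.length_cons]
    exact h.add_one

theorem triple_snd_fst {l : List ℕ} (hl : l ≠ []) :
    (triple l).2.1 = true :: (triple l).1.tail := by
  induction l with
  | nil => exact absurd rfl hl
  | cons q l ih =>
    cases l with
    | nil => rfl
    | cons j l =>
      have h1 := ih (by simp)
      have h2 : (triple (j :: l)).1 ≠ [] :=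
        (inv_triple (t := 2) le_rfl (l := j :: l) (by simp)).ne_V
      obtain ⟨d, V, hV⟩ := List.exists_cons_of_ne_nil h2
      simp only [triple, bpow_succ]
      rw [hV] at h1 ⊢
      rw [h1]
      simp

/-! ### Nodes and their positions in the tree -/

/-- The children of a node are numbered by the natural numbers, in the order of their intervals
from right to left: this is the number of `Θ_q(v)`. For `v = 1`, the operators are `Θ_{-1}`,
`Θ_1`, `Θ_2`, …. -/
def childNumber : Node → ℤ → ℕ
  | .single c, q => if c = 1 ∧ q ≠ -1 then q.toNat else (q + 1).toNat
  | .child _ _, q => q.toNat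

/-- The position of a node, for given `k`, in the tree of binary words. -/
def path (k : ℕ) : Node → List ℕ
  | .single c => List.replicate (c - 1) 0 ++ [k - 1]
  | .child q u => childNumber u q :: path k u

theorem path_ne_nil (k : ℕ) (v : Node) : path k v ≠ [] := by
  cases v <;> simp [path]

theorem baseDigit_cons (q : ℕ) {l : List ℕ} (hl : l ≠ []) :
    baseDigit (q :: l) = baseDigit l := by
  cases l with
  | nil => exact absurd rfl hl
  | cons j l => rfl

theorem triple_cons (q : ℕ) {l : List ℕ} (hl : l ≠ []) :
    triple (q :: l) = ((triple l).1 ++ (bpow (triple l).2.1 q ++ (triple l).2.2),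
      bpow (triple l).2.1 (q + 1) ++ (triple l).2.2, bpow (triple l).2.1 q ++ (triple l).2.2) := by
  cases l with
  | nil => exact absurd rfl hl
  | cons j l => rfl

theorem baseDigit_path {k : ℕ} (hk : 1 ≤ k) (v : Node) : baseDigit (path k v) = k := by
  induction v with
  | single c =>
    simp only [path]
    induction c - 1 with
    | zero => simp [baseDigit]; omega
    | succ c ih =>
      rw [List.replicate_succ, List.cons_append, baseDigit_cons _ (by simp), ih]
  | child q u ih => rw [path, baseDigit_cons _ (path_ne_nil k u), ih]

theorem triple_path_single (k c : ℕ) : triple (List.replicate c 0 ++ [k]) =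
    (List.replicate (c + 1) false, true :: List.replicate c false, [false]) := by
  induction c with
  | zero => rfl
  | succ c ih =>
    rw [List.replicate_succ, List.cons_append, triple_cons _ (by simp), ih]
    simp [bpow, List.replicate_succ']

/-- The words of a node are those of its position in the tree of binary words. This is what the
recursive definition of the words preserves, together with the parities of the lengths, on which
the letter at the start of the next run depends. For a one-letter word, only its positivity has to
be recorded. -/
def Node.IsCompatible (k : ℕ) : Node → Prop
  | .single c => 1 ≤ c
  | .child q u => ∃ c d r, (Node.child q u).wordSuffix.1 = c :: d :: r ∧ 1 ≤ c ∧
      Odd (c :: d :: r).length ∧ Even (Node.child q u).wordSuffix.2.length ∧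
      expand false (c :: d :: r) = (triple (path k (.child q u))).1 ∧
      expand true (Node.child q u).wordSuffix.2 = (triple (path k (.child q u))).2.2

theorem isCompatible_of_inTree (k : ℕ) {v : Node} (hv : InTree v) : v.IsCompatible k := by
  induction hv with
  | one => exact le_rfl
  | @theta v q hv hq ih =>
    cases v with
    | single c =>
      have hc : 1 ≤ c := ih
      obtain ⟨h1, h2⟩ := hq
      simp only [Node.Theta]
      split_ifs with h3
      · exact Nat.le_add_left 1 c
      · obtain ⟨q, rfl⟩ : ∃ q' : ℕ, q = q' := ⟨q.toNat, by omega⟩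
        rw [Int.toNat_natCast]
        rcases eq_or_ne c 1 with rfl | hc1
        · refine ⟨1, q, [1], ?_, le_rfl, ⟨1, rfl⟩, ?_, ?_, ?_⟩
          · simp [Node.wordSuffix]
          · simp [Node.wordSuffix]
          · have : path k (.child q (.single 1)) = [q, k - 1] := by
              simp [path, childNumber]
            rw [this]
            simp [triple, expand, bpow_singleton]
          · have : path k (.child q (.single 1)) = [q, k - 1] := by
              simp [path, childNumber]
            rw [this]
            simp [triple, expand, Node.wordSuffix, bpow_singleton]
        · obtain ⟨c, rfl⟩ : ∃ c', c = c' + 1 := ⟨c - 1, by omega⟩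
          have hp : path k (.child q (.single (c + 1))) =
              (q + 1) :: (List.replicate c 0 ++ [k - 1]) := by
            have : c ≠ 0 := by omega
            simp [path, childNumber, this]
          have hE : Even ([1, c] : List ℕ).length := by simp
          have hw : Even (wpow [1, c] q).length := even_length_wpow hE q
          have hx : expand true (wpow [1, c] q ++ [1, c + 1]) =
              bpow (true :: List.replicate c false) (q + 1) ++ [false] := by
            rw [(expand_append true _ _).1 hw, expand_wpow true hE, bpow_succ']
            simp [expand, List.replicate_succ']
          obtain ⟨d, r, hdr⟩ : ∃ d r, wpow [1, c] q ++ [1, c + 1] = d :: r := by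
            cases q with
            | zero => exact ⟨1, [c + 1], rfl⟩
            | succ q => exact ⟨1, _, by rw [wpow_succ]; rfl⟩
          have hE' : Even (d :: r).length := by
            rw [← hdr, List.length_append]
            exact hw.add (by simp)
          refine ⟨c + 1, d, r, ?_, by omega, ?_, ?_, ?_, ?_⟩
          · simp only [Node.wordSuffix, hc1, if_false, Nat.add_sub_cancel, hdr]
            rfl
          · rw [List.length_cons]
            exact hE'.add_one
          · simp only [Node.wordSuffix, hc1, if_false, Nat.add_sub_cancel]
            rw [hdr]
            exact hE'
          · rw [hp, triple_cons _ (by simp), triple_path_single, ← hdr]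
            simp only [expand, Bool.not_false]
            rw [hx]
          · rw [hp, triple_cons _ (by simp), triple_path_single]
            simp only [Node.wordSuffix, hc1, if_false, Nat.add_sub_cancel]
            exact hx
    | child p u =>
      have hq : 0 ≤ q := hq
      obtain ⟨q, rfl⟩ : ∃ q' : ℕ, q = q' := ⟨q.toNat, by omega⟩
      obtain ⟨c, d, r, h1, h2, h3, h4, h5, h6⟩ := ih
      simp only [Node.Theta, Int.toNat_natCast]
      have hp : path k (.child q (.child p u)) = q :: path k (.child p u) := by
        simp [path, childNumber]
      have hprime : expand true (prime (c :: d :: r)) = (triple (path k (.child p u))).2.1 := by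
        rw [expand_prime h2, h5, ← triple_snd_fst (path_ne_nil k _)]
      have hE := even_length_prime d r h3
      have hw : Even (wpow (prime (c :: d :: r)) q).length := even_length_wpow hE q
      have hx : expand true (wpow (prime (c :: d :: r)) q ++ (Node.child p u).wordSuffix.2) =
          bpow (triple (path k (.child p u))).2.1 q ++ (triple (path k (.child p u))).2.2 := by
        rw [(expand_append true _ _).1 hw, expand_wpow true hE, hprime, h6]
      have hs : (Node.child q (.child p u)).wordSuffix =
          (c :: d :: r ++ (wpow (prime (c :: d :: r)) q ++ (Node.child p u).wordSuffix.2),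
            wpow (prime (c :: d :: r)) q ++ (Node.child p u).wordSuffix.2) := by
        rw [Node.wordSuffix, h1]
      have hE' : Even (wpow (prime (c :: d :: r)) q ++ (Node.child p u).wordSuffix.2).length := by
        rw [List.length_append]
        exact hw.add h4
      refine ⟨c, d, r ++ (wpow (prime (c :: d :: r)) q ++ (Node.child p u).wordSuffix.2),
        ?_, h2, ?_, ?_, ?_, ?_⟩
      · rw [hs]
        simp
      · rw [← List.cons_append, ← List.cons_append, List.length_append]
        exact h3.add_even hE'
      · rw [hs]
        exact hE'
      · rw [hp, triple_cons _ (path_ne_nil k _), ← List.cons_append, ← List.cons_append,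
          (expand_append false _ _).2 h3, h5, Bool.not_false, hx]
      · rw [hp, triple_cons _ (path_ne_nil k _), hs]
        exact hx

theorem expand_word (k : ℕ) {v : Node} (hv : InTree v) :
    expand false v.word = (triple (path k v)).1 := by
  have h := isCompatible_of_inTree k hv
  cases v with
  | single c =>
    have hc : 1 ≤ c := h
    obtain ⟨c, rfl⟩ : ∃ c', c = c' + 1 := ⟨c - 1, by omega⟩
    simp [path, triple_path_single, Node.word, Node.wordSuffix, expand]
  | child q u =>
    obtain ⟨c, d, r, h1, -, -, -, h5, -⟩ := h
    rw [Node.word, h1, h5]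

theorem path_Theta (k : ℕ) {v : Node} (hv : InTree v) {q : ℤ} (hq : q ∈ v.indices) :
    path k (v.Theta q) = childNumber v q :: path k v := by
  cases v with
  | single c =>
    have hc : 1 ≤ c := isCompatible_of_inTree k hv
    simp only [Node.Theta]
    split_ifs with h
    · subst h
      obtain ⟨c, rfl⟩ : ∃ c', c = c' + 1 := ⟨c - 1, by omega⟩
      simp [path, childNumber, List.replicate_succ]
    · obtain ⟨q, rfl⟩ : ∃ q' : ℕ, q = q' := ⟨q.toNat, by have := hq.1; omega⟩
      simp [path]
  | child p u =>
    have hq : 0 ≤ q := hq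
    simp [path, Node.Theta, hq]

theorem injOn_childNumber (v : Node) : Set.InjOn (childNumber v) v.indices := by
  intro q hq q' hq' h
  cases v with
  | single c =>
    obtain ⟨h1, h2⟩ := hq
    obtain ⟨h3, h4⟩ := hq'
    simp only [childNumber] at h
    split_ifs at h <;> omega
  | child p u =>
    have h1 : 0 ≤ q := hq
    have h2 : 0 ≤ q' := hq'
    simp only [childNumber] at h
    omega

theorem exists_childNumber_eq (v : Node) (j : ℕ) : ∃ q ∈ v.indices, childNumber v q = j := by
  cases v with
  | single c =>
    by_cases hc : c = 1 ∧ j ≠ 0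
    · refine ⟨j, ⟨by omega, by omega⟩, ?_⟩
      rw [childNumber, if_pos ⟨hc.1, by omega⟩]
      simp
    · refine ⟨(j : ℤ) - 1, ⟨by omega, by omega⟩, ?_⟩
      rw [childNumber, if_neg (by omega)]
      simp
  | child p u => exact ⟨j, Int.natCast_nonneg j, by simp [childNumber]⟩

theorem exists_path_eq {l : List ℕ} (hl : l ≠ []) :
    ∃ k v, 1 ≤ k ∧ InTree v ∧ path k v = l := by
  induction l with
  | nil => exact absurd rfl hl
  | cons j l ih =>
    rcases eq_or_ne l [] with rfl | h
    · exact ⟨j + 1, .single 1, by omega, .one, by simp [path]⟩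
    · obtain ⟨k, v, h1, h2, h3⟩ := ih h
      obtain ⟨q, h4, h5⟩ := exists_childNumber_eq v j
      exact ⟨k, v.Theta q, h1, .theta h2 h4, by rw [path_Theta k h2 h4, h5, h3]⟩

/-! ### Möbius transformations and digits -/

theorem mu_three : mu 3 = 1 := by
  simp [mu]

theorem two_le_t {n : ℕ} (hn : 3 ≤ n) : 2 ≤ t 3 n := by
  have h1 : (3 : ℝ) ≤ n := by exact_mod_cast hn
  have h2 : Real.cos (π / 3) ≤ Real.cos (π / n) := by
    apply Real.cos_le_cos_of_nonneg_of_le_pi (by positivity)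
    · linarith [Real.pi_pos]
    · exact div_le_div_of_nonneg_left Real.pi_pos.le (by norm_num) h1
  rw [Real.cos_pi_div_three] at h2
  rw [t, mu_three, mu]
  linarith

theorem A_pow_smul (n d : ℕ) (x : ℝ) :
    A 3 n ^ d • (x : OnePoint ℝ) = ((x + d * t 3 n : ℝ) : OnePoint ℝ) := by
  induction d generalizing x with
  | zero => simp
  | succ d ih =>
    have h : A 3 n • (x : OnePoint ℝ) = ((x + t 3 n : ℝ) : OnePoint ℝ) := by
      rw [OnePoint.smul_some_eq_ite]
      simp [A]
    rw [pow_succ, mul_smul, h, ih]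
    congr 1
    push_cast
    ring

theorem C_smul {x : ℝ} (hx : x ≠ 0) :
    C 3 • (x : OnePoint ℝ) = ((1 - 1 / x : ℝ) : OnePoint ℝ) := by
  rw [OnePoint.smul_some_eq_ite]
  simp only [C, mu_three]
  simp [hx]
  field_simp
  ring

theorem C_smul_zero : C 3 • ((0 : ℝ) : OnePoint ℝ) = OnePoint.infty := by
  rw [OnePoint.smul_some_eq_ite]
  simp [C]

/-- The digit that a letter stands for. -/
def digit (k : ℕ) (d : Bool) : ℕ := if d then k + 1 else k

theorem branch_eq (t : ℝ) (k : ℕ) (d : Bool) (y : ℝ) :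
    branch (k * t + 1) t d y = 1 / (digit k d * t + 1 - y) := by
  cases d
  · rfl
  · simp only [branch, digit, if_true]
    push_cast
    congr 1
    ring

theorem le_digit (k : ℕ) (d : Bool) : k ≤ digit k d := by
  cases d <;> simp [digit]

theorem tStep_iff {n : ℕ} (hn : 3 ≤ n) {α : ℝ} (hα : α ≤ 1) {d : ℕ} (hd : 1 ≤ d) {x y : ℝ} :
    TStep 3 n α x d 1 y ↔
      y ∈ Set.Ico (α * t 3 n - t 3 n) (α * t 3 n) ∧ x = 1 / (d * t 3 n + 1 - y) := by
  have ht := two_le_t hn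
  have ht0 : 0 < t 3 n := by linarith
  have hd' : (1 : ℝ) ≤ d := by exact_mod_cast hd
  constructor
  · rintro ⟨-, -, ⟨z, -, hz, hk⟩, hy⟩
    rw [pow_one] at hz
    have hx : x ≠ 0 := by
      rintro rfl
      rw [C_smul_zero] at hz
      exact OnePoint.infty_ne_coe _ hz
    rw [C_smul hx, OnePoint.coe_eq_coe] at hz
    rw [zpow_natCast, pow_one, mul_smul, C_smul hx, A_pow_smul, OnePoint.coe_eq_coe] at hy
    have hf : ⌊z / t 3 n + 1 - α⌋ = -(d : ℤ) := by omega
    rw [Int.floor_eq_iff] at hf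
    push_cast at hf
    have h1 : z / t 3 n * t 3 n = z := div_mul_cancel₀ _ ht0.ne'
    refine ⟨⟨?_, ?_⟩, ?_⟩
    · nlinarith [mul_le_mul_of_nonneg_right hf.1 ht0.le]
    · nlinarith [mul_lt_mul_of_pos_right hf.2 ht0]
    · rw [← hy]
      have : (d : ℝ) * t 3 n + 1 - (1 - 1 / x + d * t 3 n) = 1 / x := by ring
      rw [this, one_div_one_div]
  · rintro ⟨hy, hx⟩
    have h1 : 0 < d * t 3 n + 1 - y := by nlinarith [hy.2]
    have hx0 : x ≠ 0 := by
      rw [hx]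
      exact (one_div_pos.2 h1).ne'
    have h2 : 1 - 1 / x = y - d * t 3 n := by
      rw [hx, one_div_one_div]
      ring
    refine ⟨le_rfl, fun j h3 h4 => by omega, ⟨y - d * t 3 n, ?_, ?_, ?_⟩, ?_⟩
    · intro h3
      have h4 : (α - 1) * t 3 n ≤ y - d * t 3 n := h3.1
      nlinarith [hy.2]
    · rw [pow_one, C_smul hx0, h2]
    · have : ⌊(y - d * t 3 n) / t 3 n + 1 - α⌋ = -(d : ℤ) := by
        rw [Int.floor_eq_iff]
        have h3 : (y - d * t 3 n) / t 3 n = y / t 3 n - d := by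
          field_simp
        have h4 : α - 1 ≤ y / t 3 n := by
          rw [le_div_iff₀ ht0]
          linarith [hy.1]
        have h5 : y / t 3 n < α := by
          rw [div_lt_iff₀ ht0]
          exact hy.2
        push_cast
        rw [h3]
        constructor <;> linarith
      omega
    · rw [zpow_natCast, pow_one, mul_smul, C_smul hx0, A_pow_smul, h2]
      congr 1
      ring

theorem hasDigits_iff {n : ℕ} (hn : 3 ≤ n) {α : ℝ} (hα : α ≤ 1) {k : ℕ} (hk : 1 ≤ k)
    (w : List Bool) (x : ℝ) :
    HasDigits 3 n α (w.map fun d => ((digit k d : ℤ), 1)) x ↔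
      ∃ y, x = pull (k * t 3 n + 1) (t 3 n) w y ∧
        Adm (k * t 3 n + 1) (t 3 n) (α * t 3 n) w y := by
  induction w generalizing x with
  | nil => simp [HasDigits, pull, Adm]
  | cons d w ih =>
    simp only [List.map_cons, HasDigits]
    simp only [tStep_iff hn hα (hk.trans (le_digit k d)), ih, pull, Adm, branch_eq]
    constructor
    · rintro ⟨z, ⟨h1, h2⟩, y, rfl, h3⟩
      exact ⟨y, h2, h1, h3⟩
    · rintro ⟨y, h1, h2, h3⟩
      exact ⟨_, ⟨h2, h1⟩, y, rfl, h3⟩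

theorem runs_eq_map_expand (k : ℕ) (d : Bool) (w : List ℕ) :
    runs (digit k d) (digit k (!d)) w = (expand d w).map fun d => (digit k d : ℤ) := by
  induction w generalizing d with
  | nil => rfl
  | cons c w ih =>
    have := ih (!d)
    rw [Bool.not_not] at this
    simp [runs, expand, this]

theorem mem_alphaCylinder_iff {n : ℕ} (hn : 3 ≤ n) {α : ℝ} {k : ℕ} (hk : 1 ≤ k) (w : List ℕ) :
    α ∈ alphaCylinder n k w ↔ α ∈ Set.Icc (0 : ℝ) 1 ∧
      Cyl (k * t 3 n + 1) (t 3 n) (expand false w) (α * t 3 n) := by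
  refine and_congr_right fun hα => ?_
  have h : digitSeq k w = _ := runs_eq_map_expand k false w
  rw [h, List.map_map]
  exact hasDigits_iff hn hα.2 hk _ _

/-- The first digit forces `r₀ < 1`. -/
theorem Cyl.lt_one {t : ℝ} (ht : 2 ≤ t) {k : ℕ} (hk : 1 ≤ k) {w : List Bool} (hw : w ≠ []) {x : ℝ}
    (hx : x ≤ t) (h : Cyl (k * t + 1) t w x) : x < 1 := by
  obtain ⟨d, w, rfl⟩ := List.exists_cons_of_ne_nil hw
  obtain ⟨y, h1, h2, -⟩ := h
  have hk' : (1 : ℝ) ≤ digit k d := by exact_mod_cast hk.trans (le_digit k d)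
  rw [h1, pull, branch_eq, div_lt_one] <;> nlinarith [h2.2]

theorem mem_alphaCylinder_word_iff {n : ℕ} (hn : 3 ≤ n) {k : ℕ} (hk : 1 ≤ k) {v : Node}
    (hv : InTree v) : alphaCylinder n k v.word =
      Set.Ico (leftEnd (t 3 n) (path k v) / t 3 n) (rightEnd (t 3 n) (path k v) / t 3 n) := by
  have ht := two_le_t hn
  have ht0 : 0 < t 3 n := by linarith
  have hne := path_ne_nil k v
  have hI := inv_triple ht hne
  have hc : shiftConst (t 3 n) (path k v) = k * t 3 n + 1 := by
    rw [shiftConst, baseDigit_path hk]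
  ext α
  rw [mem_alphaCylinder_iff hn hk, expand_word k hv, Set.mem_Ico, div_le_iff₀ ht0, lt_div_iff₀ ht0]
  have hiff := fun hx => cyl_triple_iff ht hne (x := α * t 3 n) hx
  rw [hc] at hiff
  constructor
  · rintro ⟨hα, h⟩
    have h1 := h.lt_one ht hk hI.ne_V (by nlinarith [hα.2])
    exact (hiff ⟨by nlinarith [hα.1], h1.le⟩).1 h
  · intro h
    have h1 := (zeta_spec (three_le_shiftConst ht hne) ht hI.ne_V).1.1
    have h2 := hI.omega_mem (three_le_shiftConst ht hne) ht
    have h3 : 0 < α * t 3 n := h1.trans_le h.1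
    have h4 : α * t 3 n ≤ 1 / 2 := h.2.le.trans h2.2
    exact ⟨⟨by nlinarith, by nlinarith⟩, (hiff ⟨h3.le, by linarith⟩).2 h⟩

/-! ### The defining equations of the endpoints -/

theorem A_pow_mul_C_smul {n : ℕ} (hn : 3 ≤ n) {k : ℕ} (hk : 1 ≤ k) (d : Bool) {y : ℝ}
    (hy : y ≤ 1) : (A 3 n ^ (digit k d : ℤ) * C 3) •
      ((branch (k * t 3 n + 1) (t 3 n) d y : ℝ) : OnePoint ℝ) = y := by
  have ht := two_le_t hn
  have h1 := branch_bounds (three_le_mul_add_one ht hk) ht d hy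
  rw [zpow_natCast, mul_smul, C_smul h1.1.ne', A_pow_smul, branch_eq, one_div_one_div]
  congr 1
  ring

theorem A_pow_mul_C_pow_smul {n : ℕ} (hn : 3 ≤ n) {k : ℕ} (hk : 1 ≤ k) (d : Bool) (c : ℕ)
    (w : List Bool) {y : ℝ} (hy : y ≤ 1) : (A 3 n ^ (digit k d : ℤ) * C 3) ^ c •
      ((pull (k * t 3 n + 1) (t 3 n) (List.replicate c d ++ w) y : ℝ) : OnePoint ℝ) =
      (pull (k * t 3 n + 1) (t 3 n) w y : ℝ) := by
  have ht := two_le_t hn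
  induction c with
  | zero => simp
  | succ c ih =>
    rw [pow_succ, mul_smul, List.replicate_succ, List.cons_append, pull,
      A_pow_mul_C_smul hn hk d (pull_le_one (three_le_mul_add_one ht hk) ht _ hy), ih]

theorem runMatrix_smul {n : ℕ} (hn : 3 ≤ n) {k : ℕ} (hk : 1 ≤ k) (d : Bool) (w : List ℕ) {y : ℝ}
    (hy : y ≤ 1) : runMatrix n (digit k d) (digit k (!d)) w •
      ((pull (k * t 3 n + 1) (t 3 n) (expand d w) y : ℝ) : OnePoint ℝ) = y := by
  induction w generalizing d with
  | nil => simp [runMatrix, expand, pull]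
  | cons c w ih =>
    have := ih (!d)
    rw [Bool.not_not] at this
    rw [runMatrix, mul_smul, expand, A_pow_mul_C_pow_smul hn hk d c _ hy, this]

/-- The matrix `R_{k,v}` inverts the composite of the inverse branches. -/
theorem rightMatrix_smul_eq_iff {n : ℕ} (hn : 3 ≤ n) {k : ℕ} (hk : 1 ≤ k) (w : List ℕ) {x y : ℝ}
    (hy : y ≤ 1) : rightMatrix n k w • (x : OnePoint ℝ) = y ↔
      pull (k * t 3 n + 1) (t 3 n) (expand false w) y = x := by
  have h := runMatrix_smul hn hk false w hy
  simp only [digit, Bool.not_false, if_true] at h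
  push_cast at h
  change rightMatrix n k w • _ = _ at h
  conv_lhs => rw [← h]
  rw [smul_left_cancel_iff, OnePoint.coe_eq_coe, eq_comm]

theorem isZeta_iff {n : ℕ} (hn : 3 ≤ n) {k : ℕ} (hk : 1 ≤ k) {w : List ℕ}
    (hw : expand false w ≠ []) (α : ℝ) :
    IsZeta n k w α ↔ α = zeta (k * t 3 n + 1) (t 3 n) (expand false w) / t 3 n := by
  have ht := two_le_t hn
  have hc := three_le_mul_add_one ht hk
  have ht0 : 0 < t 3 n := by linarith
  have hz := zeta_spec hc ht hw
  rw [eq_div_iff ht0.ne', IsZeta]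
  have hell : ell0 3 n α = α * t 3 n - t 3 n := by
    rw [ell0]
    ring
  constructor
  · rintro ⟨hα, h⟩
    have h1 : α * t 3 n - t 3 n ≤ 1 := by nlinarith [hα.2]
    rw [hell, rightMatrix_smul_eq_iff hn hk w h1, r0] at h
    have h2 := (pull_bounds hc ht hw h1).2
    rw [h] at h2
    exact (hz.eq_iff ⟨by nlinarith [hα.1], by linarith⟩).2 h
  · intro h
    have h1 := hz.1
    rw [← h] at h1
    refine ⟨⟨by nlinarith [h1.1], by nlinarith [h1.2]⟩, ?_⟩
    rw [hell, rightMatrix_smul_eq_iff hn hk w (by linarith [h1.2]), r0]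
    exact (hz.eq_iff ⟨h1.1.le, h1.2.le⟩).1 h

theorem C_inv_mul_A_mul_C_smul {n : ℕ} (hn : 3 ≤ n) {x : ℝ} (hx : 0 ≤ x) :
    ((C 3)⁻¹ * A 3 n * C 3) • ((x / (1 + t 3 n * x) : ℝ) : OnePoint ℝ) = x := by
  have ht := two_le_t hn
  rw [mul_assoc, mul_smul, inv_smul_eq_iff, mul_smul]
  rcases hx.eq_or_lt with rfl | hx
  · rw [zero_div, C_smul_zero, OnePoint.smul_infty_eq_self_iff]
    simp [A]
  · have h1 : 0 < 1 + t 3 n * x := by positivity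
    have h2 := A_pow_smul n 1
    simp only [pow_one] at h2
    rw [C_smul (by positivity), C_smul hx.ne', h2]
    congr 1
    field_simp
    push_cast
    ring

theorem isEta_iff {n : ℕ} (hn : 3 ≤ n) {k : ℕ} (hk : 1 ≤ k) {w : List ℕ}
    (hw : expand false w ≠ []) (α : ℝ) :
    IsEta n k w α ↔ α = eta (k * t 3 n + 1) (t 3 n) (expand false w) / t 3 n := by
  have ht := two_le_t hn
  have hc := three_le_mul_add_one ht hk
  have ht0 : 0 < t 3 n := by linarith
  have hz := eta_spec hc ht hw
  rw [eq_div_iff ht0.ne', IsEta]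
  have key : ∀ x : ℝ, 0 ≤ x →
      (((C 3)⁻¹ * A 3 n * C 3 * rightMatrix n k w) • (x : OnePoint ℝ) = x ↔
        pull (k * t 3 n + 1) (t 3 n) (expand false w) (x / (1 + t 3 n * x)) = x) := by
    intro x hx
    rw [← rightMatrix_smul_eq_iff hn hk w (div_one_add_mul_le ht hx).2, mul_smul]
    conv_lhs => rhs; rw [← C_inv_mul_A_mul_C_smul hn hx]
    rw [smul_left_cancel_iff]
  constructor
  · rintro ⟨hα, h⟩
    have h0 : 0 ≤ α * t 3 n := mul_nonneg hα.1 ht0.le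
    rw [r0, key _ h0] at h
    have h2 := (pull_bounds hc ht hw (div_one_add_mul_le ht h0).2).2
    rw [h] at h2
    exact (hz.eq_iff ⟨h0, by linarith⟩).2 h
  · intro h
    have h1 := hz.1
    rw [← h] at h1
    refine ⟨⟨by nlinarith [h1.1], by nlinarith [h1.2]⟩, ?_⟩
    rw [r0, key _ h1.1.le]
    exact (hz.eq_iff ⟨h1.1.le, h1.2.le⟩).1 h

theorem isGamma_iff {n : ℕ} (hn : 3 ≤ n) (α : ℝ) :
    IsGamma n α ↔ α = rightEnd (t 3 n) [] / t 3 n := by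
  have ht := two_le_t hn
  have ht0 : 0 < t 3 n := by linarith
  have hz := fixedPt_spec (c := 1 * t 3 n + 1) (by linarith) ht
  rw [eq_div_iff ht0.ne', IsGamma, inv_smul_eq_iff]
  have hell : ell0 3 n α = α * t 3 n - t 3 n := by
    rw [ell0]
    ring
  have key : ∀ x : ℝ, 0 < x → x ≤ t 3 n → (x - t 3 n = 1 - 1 / x ↔
      branch (1 * t 3 n + 1) (t 3 n) false x = x) := by
    intro x hx hx'
    have h1 : 1 * t 3 n + 1 - x ≠ 0 := by linarith
    simp only [branch]
    rw [div_eq_iff h1]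
    constructor
    · intro h
      have : 1 / x = 1 * t 3 n + 1 - x := by linarith
      rw [← this, mul_one_div_cancel hx.ne']
    · intro h
      have : 1 / x = 1 * t 3 n + 1 - x := by
        rw [div_eq_iff hx.ne', mul_comm]
        exact h
      linarith
  change _ ↔ α * t 3 n = fixedPt (1 * t 3 n + 1) (t 3 n)
  rw [hell, r0]
  constructor
  · rintro ⟨hα, h⟩
    have h0 : α * t 3 n ≠ 0 := by
      intro h0
      rw [h0, C_smul_zero] at h
      exact OnePoint.coe_ne_infty _ h
    have h1 : 0 < α * t 3 n := lt_of_le_of_ne (mul_nonneg hα.1 ht0.le) h0.symm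
    have h2 : α * t 3 n ≤ t 3 n := by nlinarith [hα.2]
    rw [C_smul h0, OnePoint.coe_eq_coe, key _ h1 h2] at h
    refine (hz.eq_iff ⟨h1.le, ?_⟩).2 h
    rw [← h]
    exact div_le_one_of_le₀ (by linarith) (by linarith)
  · intro h
    have h1 := hz.1
    rw [← h] at h1
    refine ⟨⟨by nlinarith [h1.1], by nlinarith [h1.2]⟩, ?_⟩
    rw [C_smul h1.1.ne', OnePoint.coe_eq_coe, key _ h1.1 (by linarith [h1.2])]
    exact (hz.eq_iff ⟨h1.1.le, h1.2.le⟩).1 h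

/-- Every node of the tree of binary words other than the root is the position of a word. -/
theorem iUnion_path (F : List ℕ → Set ℝ) (G : ℕ → Node → Set ℝ)
    (h : ∀ k, 1 ≤ k → ∀ v, InTree v → G k v = F (path k v)) :
    ⋃ k ∈ Set.Ici (1 : ℕ), ⋃ v ∈ {v | InTree v}, G k v = ⋃ l ∈ {l : List ℕ | l ≠ []}, F l := by
  ext x
  simp only [Set.mem_iUnion, Set.mem_Ici, Set.mem_ofPred_eq, exists_prop]
  constructor
  · rintro ⟨k, hk, v, hv, hx⟩
    exact ⟨path k v, path_ne_nil k v, by rwa [← h k hk v hv]⟩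
  · rintro ⟨l, hl, hx⟩
    obtain ⟨k, v, hk, hv, rfl⟩ := exists_path_eq hl
    exact ⟨k, hk, v, hv, by rwa [h k hk v hv]⟩

end AlphaCF

theorem mainTheorem5 (n : ℕ) (hn : 3 ≤ n) :
    ∃ (γ : ℝ) (ζ η : ℕ → List ℕ → ℝ),
      -- `γ = γ_{3,n}`, `ζ k v = ζ_{k,v}`, `η k v = η_{k,v}` are well defined
      (∀ α : ℝ, AlphaCF.IsGamma n α ↔ α = γ) ∧
      (∀ k : ℕ, 1 ≤ k → ∀ v : AlphaCF.Node, AlphaCF.InTree v →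
        (∀ α : ℝ, AlphaCF.IsZeta n k v.word α ↔ α = ζ k v.word) ∧
        (∀ α : ℝ, AlphaCF.IsEta n k v.word α ↔ α = η k v.word) ∧
        ζ k v.word < η k v.word) ∧
      -- the partition of `(0, γ)`
      Set.Ioo 0 γ = ⋃ k ∈ Set.Ici (1 : ℕ), AlphaCF.alphaCylinder n k [1] ∧
      (Set.Ici (1 : ℕ)).PairwiseDisjoint (fun k => AlphaCF.alphaCylinder n k [1]) ∧
      -- the partition of each cylinder
      (∀ k : ℕ, 1 ≤ k → ∀ v : AlphaCF.Node, AlphaCF.InTree v →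
        AlphaCF.alphaCylinder n k v.word =
          Set.Ico (ζ k v.word) (η k v.word) ∪ {η k v.word} ∪
            ⋃ q ∈ v.indices, AlphaCF.alphaCylinder n k (v.Theta q).word ∧
        (∀ q ∈ v.indices,
          Disjoint (Set.Ico (ζ k v.word) (η k v.word))
            (AlphaCF.alphaCylinder n k (v.Theta q).word) ∧
          η k v.word ∉ AlphaCF.alphaCylinder n k (v.Theta q).word) ∧
        v.indices.PairwiseDisjoint
          (fun q => AlphaCF.alphaCylinder n k (v.Theta q).word)) ∧
      -- the complement is a Cantor set
      closure (Set.Ioo 0 γ \ ⋃ k ∈ Set.Ici (1 : ℕ), ⋃ v ∈ {v | AlphaCF.InTree v},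
          Set.Ico (ζ k v.word) (η k v.word)) =
        Set.Icc 0 γ \ ⋃ k ∈ Set.Ici (1 : ℕ), ⋃ v ∈ {v | AlphaCF.InTree v},
          Set.Ioo (ζ k v.word) (η k v.word) ∧
      AlphaCF.IsCantorSet
        (Set.Icc 0 γ \ ⋃ k ∈ Set.Ici (1 : ℕ), ⋃ v ∈ {v | AlphaCF.InTree v},
          Set.Ioo (ζ k v.word) (η k v.word)) := by
  have ht := AlphaCF.two_le_t hn
  have ht0 : 0 < AlphaCF.t 3 n := by linarith
  set s := AlphaCF.t 3 n with hs
  have hT := (AlphaCF.gapTree ht).div_const ht0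
  have hexp : ∀ {k : ℕ}, 1 ≤ k → ∀ {v : AlphaCF.Node}, AlphaCF.InTree v →
      AlphaCF.expand false v.word ≠ [] ∧
      AlphaCF.zeta (k * s + 1) s (AlphaCF.expand false v.word) =
        AlphaCF.leftEnd s (AlphaCF.path k v) ∧
      AlphaCF.eta (k * s + 1) s (AlphaCF.expand false v.word) =
        AlphaCF.gapEnd s (AlphaCF.path k v) := by
    intro k hk v hv
    have h1 := AlphaCF.path_ne_nil k v
    obtain ⟨j, l, hl⟩ := List.exists_cons_of_ne_nil h1
    rw [AlphaCF.expand_word k hv]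
    refine ⟨(AlphaCF.inv_triple ht h1).ne_V, ?_, ?_⟩
    · rw [AlphaCF.leftEnd, AlphaCF.shiftConst, AlphaCF.baseDigit_path hk]
    · rw [hl, AlphaCF.gapEnd, ← hl, AlphaCF.shiftConst, AlphaCF.baseDigit_path hk]
  have hcyl : ∀ {k : ℕ}, 1 ≤ k → ∀ {v : AlphaCF.Node}, AlphaCF.InTree v →
      AlphaCF.alphaCylinder n k v.word = Set.Ico (AlphaCF.leftEnd s (AlphaCF.path k v) / s)
        (AlphaCF.rightEnd s (AlphaCF.path k v) / s) :=
    fun hk _ hv => AlphaCF.mem_alphaCylinder_word_iff hn hk hv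
  have hone : ∀ {k : ℕ}, 1 ≤ k → AlphaCF.alphaCylinder n k [1] =
      Set.Ico (AlphaCF.leftEnd s [k - 1] / s) (AlphaCF.rightEnd s [k - 1] / s) :=
    fun hk => hcyl hk AlphaCF.InTree.one
  have hE : AlphaCF.gapEnd s [] / s = 0 := zero_div _
  refine ⟨AlphaCF.rightEnd s [] / s,
    fun k w => AlphaCF.zeta (k * s + 1) s (AlphaCF.expand false w) / s,
    fun k w => AlphaCF.eta (k * s + 1) s (AlphaCF.expand false w) / s,
    AlphaCF.isGamma_iff hn, ?_, ?_, ?_, ?_, ?_, ?_⟩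
  · intro k hk v hv
    obtain ⟨h1, h2, h3⟩ := hexp hk hv
    refine ⟨AlphaCF.isZeta_iff hn hk h1, AlphaCF.isEta_iff hn hk h1, ?_⟩
    simp only [h2, h3]
    exact hT.gap _ (AlphaCF.path_ne_nil k v)
  · ext x
    simp only [Set.mem_iUnion, Set.mem_Ici, exists_prop]
    constructor
    · intro hx
      rw [← hE] at hx
      obtain ⟨q, hq⟩ := hT.exists_child hx
      refine ⟨q + 1, by omega, ?_⟩
      rw [hone (by omega)]
      exact hq
    · rintro ⟨k, hk, hx⟩
      rw [hone hk] at hx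
      rw [← hE]
      exact hT.child_subset hx
  · intro k hk k' hk' hne
    rw [Function.onFun, hone hk, hone hk', Set.disjoint_left]
    intro x hx hx'
    have h1 := hT.child_unique hx hx'
    have h2 : 1 ≤ k := hk
    have h3 : 1 ≤ k' := hk'
    omega
  · intro k hk v hv
    obtain ⟨-, h2, h3⟩ := hexp hk hv
    have hne := AlphaCF.path_ne_nil k v
    have hch : ∀ q ∈ v.indices, AlphaCF.alphaCylinder n k (v.Theta q).word =
        Set.Ico (AlphaCF.leftEnd s (AlphaCF.childNumber v q :: AlphaCF.path k v) / s)
          (AlphaCF.rightEnd s (AlphaCF.childNumber v q :: AlphaCF.path k v) / s) := by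
      intro q hq
      rw [hcyl hk (.theta hv hq), AlphaCF.path_Theta k hv hq]
    simp only [h2, h3]
    refine ⟨?_, ?_, ?_⟩
    · rw [hcyl hk hv]
      ext x
      simp only [Set.mem_union, Set.mem_singleton_iff, Set.mem_iUnion, exists_prop]
      constructor
      · intro hx
        rcases lt_trichotomy x (AlphaCF.gapEnd s (AlphaCF.path k v) / s) with h4 | h4 | h4
        · exact Or.inl (Or.inl ⟨hx.1, h4⟩)
        · exact Or.inl (Or.inr h4)
        · obtain ⟨j, hj⟩ := hT.exists_child ⟨h4, hx.2⟩
          obtain ⟨q, hq, rfl⟩ := AlphaCF.exists_childNumber_eq v j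
          exact Or.inr ⟨q, hq, by rw [hch q hq]; exact hj⟩
      · rintro ((hx | rfl) | ⟨q, hq, hx⟩)
        · exact ⟨hx.1, hx.2.trans (hT.rest _)⟩
        · exact ⟨(hT.gap _ hne).le, hT.rest _⟩
        · rw [hch q hq] at hx
          have := hT.child_subset hx
          exact hT.Ico_subset_Ioo hne ⟨this.1.le, this.2⟩
    · intro q hq
      rw [hch q hq, Set.disjoint_left]
      refine ⟨fun x hx hx' => lt_asymm hx.2 (hT.child_subset hx').1,
        fun hx => lt_irrefl _ (hT.child_subset hx).1⟩
    · intro q hq q' hq' hqq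
      rw [Function.onFun, hch q hq, hch q' hq', Set.disjoint_left]
      exact fun x hx hx' => hqq (AlphaCF.injOn_childNumber v hq hq' (hT.child_unique hx hx'))
  · have h1 := hT.closure_diff
    rw [AlphaCF.iUnion_path
        (fun l => Set.Ico (AlphaCF.leftEnd s l / s) (AlphaCF.gapEnd s l / s)),
      AlphaCF.iUnion_path
        (fun l => Set.Ioo (AlphaCF.leftEnd s l / s) (AlphaCF.gapEnd s l / s))]
    · rwa [hE] at h1
    all_goals
      intro k hk v hv
      obtain ⟨-, h2, h3⟩ := hexp hk hv
      simp only [h2, h3]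
  · have h1 := hT.isCantorSet
    rw [AlphaCF.iUnion_path
        (fun l => Set.Ioo (AlphaCF.leftEnd s l / s) (AlphaCF.gapEnd s l / s))]
    · rwa [hE] at h1
    · intro k hk v hv
      obtain ⟨-, h2, h3⟩ := hexp hk hv
      simp only [h2, h3]
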